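/- Let $n\ge 1$ and $p$ be natural numbers, let $\boldsymbol\Sigma\in\mathbb R^{p\times p}$ be a symmetric positive semidefinite matrix (possibly singular), and let $\mathbf Z\in\mathbb R^{n\times p}$ be a random matrix with i.i.d. $\mathcal N_p(0,\boldsymbol\Sigma)$ rows. Write $\mathbf Z^{(n)}=\mathbf Z/\sqrt n$, let $\mathbb B_1^k$ and $\mathbb B_2^k$ be the closed unit balls of the $\ell_1$ norm and of the Euclidean norm in $\mathbb R^k$, and for a compact set $B\subset\mathbb R^k$ let $\mathscr G(B)=\mathbb E\big[\sup_{b\in B}b^\top\xi\big]$, with $\xi\sim\mathcal N_k(0,\mathbf I_k)$, be its Gaussian width. Then, for every $\delta\in(0,1]$, with probability at least $1-\delta$ the following holds simultaneously for all $v\in\mathbb R^p$ and $u\in\mathbb R^n$: $$ \big|u^\top\mathbf Z^{(n)}v\big|\le \|\boldsymbol\Sigma^{1/2}v\|_2\,\|u\|_2\sqrt{\tfrac{2}{n}}\,\Big(4.8+\sqrt{\log(81/\delta)}\Big) +1.2\,\|v\|_1\|u\|_2\,\frac{\mathscr G(\boldsymbol\Sigma^{1/2}\mathbb B_1^p)}{\sqrt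 n} +1.2\,\|\boldsymbol\Sigma^{1/2}v\|_2\,\frac{\mathscr G\big(\|u\|_1\mathbb B_1^n\cap\|u\|_2\mathbb B_2^n\big)}{\sqrt n}. $$ -/

import Mathlib

open MeasureTheory ProbabilityTheory
open scoped RealInnerProductSpace Pointwise

/-- The `ℓ₁` norm of a vector of `ℝᵏ`. -/
noncomputable def l1Norm {k : ℕ} (x : EuclideanSpace ℝ (Fin k)) : ℝ :=
  ∑ i, |x i|

/-- The closed unit ball `𝔹₁ᵏ` of the `ℓ₁` norm in `ℝᵏ`. -/
def unitBall1 (k : ℕ) : Set (EuclideanSpace ℝ (Fin k)) :=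
  {x | l1Norm x ≤ 1}

/-- The closed unit ball `𝔹₂ᵏ` of the Euclidean norm in `ℝᵏ`. -/
def unitBall2 (k : ℕ) : Set (EuclideanSpace ℝ (Fin k)) :=
  {x | ‖x‖ ≤ 1}

/-- The Gaussian width `𝒢(B) = E [sup_{b ∈ B} bᵀ ξ]`, where `ξ` is a standard Gaussian vector
of `ℝᵏ`, of a (nonempty compact) set `B`. -/
noncomputable def gaussianWidth {k : ℕ} (B : Set (EuclideanSpace ℝ (Fin k))) : ℝ :=
  ∫ ξ, (⨆ b : B, ⟪(b : EuclideanSpace ℝ (Fin k)), ξ⟫) ∂stdGaussian (EuclideanSpace ℝ (Fin k))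

open scoped MatrixOrder in
/-- The symmetric positive semidefinite square root `Σ^{1/2}` of a positive semidefinite
matrix, as a linear operator on Euclidean space. -/
noncomputable def covSqrt {k : ℕ} (S : Matrix (Fin k) (Fin k) ℝ) :
    EuclideanSpace ℝ (Fin k) →L[ℝ] EuclideanSpace ℝ (Fin k) :=
  Matrix.toEuclideanCLM (𝕜 := ℝ) (CFC.sqrt S)

/-- The `i`-th row of a matrix, as a vector of Euclidean space. -/
def rowVec {n p : ℕ} (A : Matrix (Fin n) (Fin p) ℝ) (i : Fin n) : EuclideanSpace ℝ (Fin p) :=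
  WithLp.toLp 2 (A i)

/-- The random matrix `Z`, defined on the probability space `(Ω, P)`, has independent rows
with common law `𝒩ₚ(0, S)`. -/
structure HasIIDGaussianRows {Ω : Type*} [MeasurableSpace Ω] (P : Measure Ω) {n p : ℕ}
    (S : Matrix (Fin p) (Fin p) ℝ) (Z : Ω → Matrix (Fin n) (Fin p) ℝ) : Prop where
  hasLaw : ∀ i, HasLaw (fun ω => rowVec (Z ω) i) (multivariateGaussian 0 S) P
  indep : iIndepFun (fun i ω => rowVec (Z ω) i) P

/-! In law the rows of `Z` are `Σ^{1/2}` applied to standard Gaussian rows, so the task is to bound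
`Σ u_a w_b x_(a,b)` with `w = Σ^{1/2} v` and `x` standard Gaussian. By homogeneity `u` and `w` may
be taken of norm one; rows are almost surely orthogonal to the kernel of `Σ^{1/2}`, which disposes
of the vectors `v` that cannot be normalized.

The core is Chevet's comparison: on pairs of unit vectors, `⟨u ⊗ w, x⟩` has smaller increments than
`⟨u, ξ⟩ + ⟨w, η⟩`, with `ξ`, `η` independent standard Gaussian vectors. Comparison of expected
maxima and concentration come together. Let `F_a`, `F_b` be smooth maxima of two independent
Gaussian processes, the first with covariances at most 1 and smaller increments. Rotating from `b`
to `a` inside the smooth maximum while the weight `exp(l F_a)` stays fixed, Gaussian integration by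
parts gives `E[F_a exp(l F_a)] ≤ (E F_b + l) E[exp(l F_a)]` (`integral_logSumExp_mul_exp_le_mul`).
This differential inequality for the moment generating function integrates to a sub-Gaussian bound
around `E F_b` (`integral_exp_logSumExp_le`). Chernoff's bound and inverse temperature tending to
infinity give a tail free of the number of indices (`measureReal_exists_le_dotProduct_le`), hence
valid for arbitrary index sets by compactness (`measure_exists_lt_bilin_le`).

The two widths depend on `u` and `v`, so a union bound over shells of width 3 in both quantities
makes the estimate uniform (`HasIIDGaussianRows.measure_exists_unit_le`). The deviation level grows
linearly with the shell indices, which keeps the total probability below `δ` at the price of the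
factor 1.2. -/

/-! ### Gaussian integration by parts -/

/-- Stein's identity for the standard Gaussian measure on the line. -/
theorem integral_id_mul_gaussianReal {h h' : ℝ → ℝ} (hd : ∀ x, HasDerivAt h (h' x) x)
    (hi : Integrable h (gaussianReal 0 1)) (hi' : Integrable h' (gaussianReal 0 1))
    (hxi : Integrable (fun x => x * h x) (gaussianReal 0 1)) :
    ∫ x, x * h x ∂gaussianReal 0 1 = ∫ x, h' x ∂gaussianReal 0 1 := by
  have key : ∀ f : ℝ → ℝ, Integrable f (gaussianReal 0 1) →
      Integrable (fun x => gaussianPDFReal 0 1 x * f x) := by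
    intro f hf
    rw [gaussianReal_of_var_ne_zero 0 one_ne_zero, integrable_withDensity_iff_integrable_smul'
      (measurable_gaussianPDF 0 1) (Filter.Eventually.of_forall fun x => gaussianPDF_lt_top)] at hf
    simpa using hf
  have hpdf : ∀ x, HasDerivAt (gaussianPDFReal 0 1) (- (x * gaussianPDFReal 0 1 x)) x := by
    intro x
    have h1 : HasDerivAt (fun y : ℝ => -(y - 0) ^ 2 / (2 * ((1 : NNReal) : ℝ))) (-x) x := by
      have := (((hasDerivAt_id x).pow 2).neg).div_const 2
      simp only [NNReal.coe_one, mul_one, sub_zero]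
      convert! this using 1
      simp
      ring
    have h2 := (h1.exp).const_mul (√(2 * Real.pi * ((1 : NNReal) : ℝ)))⁻¹
    rw [gaussianPDFReal_def]
    convert! h2 using 1
    ring
  -- The density satisfies `φ' = -xφ`, so the identity is integration by parts on the line; the
  -- integrability of `φ h` removes the boundary terms.
  have := integral_mul_deriv_eq_deriv_mul_of_integrable (u := gaussianPDFReal 0 1) (v := h)
    (u' := fun x => - (x * gaussianPDFReal 0 1 x)) (v' := h') (fun x _ => hpdf x) (fun x _ => hd x)
    (key _ hi') ((key _ hxi).neg.congr (Filter.Eventually.of_forall fun x => by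
      simp only [Pi.mul_apply, Pi.neg_apply]; ring)) (key _ hi)
  rw [integral_gaussianReal_eq_integral_smul one_ne_zero,
    integral_gaussianReal_eq_integral_smul one_ne_zero]
  simp only [smul_eq_mul]
  rw [this, ← integral_neg]
  congr 1
  ext x
  ring

/-- The law of a standard Gaussian vector indexed by a finite type. -/
noncomputable abbrev stdGaussianPi (κ : Type*) [Fintype κ] : Measure (κ → ℝ) :=
  Measure.pi fun _ => gaussianReal 0 1

/-- Resampling one coordinate of a product of probability measures preserves it. -/
theorem measurePreserving_update_pi {κ : Type*} [Fintype κ] [DecidableEq κ] {α : κ → Type*}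
    [∀ i, MeasurableSpace (α i)] (μ : ∀ i, Measure (α i)) [∀ i, IsProbabilityMeasure (μ i)] (k : κ) :
    MeasurePreserving (fun q : (∀ i, α i) × α k => Function.update q.1 k q.2)
      ((Measure.pi μ).prod (μ k)) (Measure.pi μ) := by
  have hm : Measurable (fun q : (∀ i, α i) × α k => Function.update q.1 k q.2) := by
    exact measurable_update'
  refine ⟨hm, (Measure.pi_eq fun s hs => ?_).symm⟩
  rw [Measure.map_apply hm (MeasurableSet.univ_pi hs)]
  have : (fun q : (∀ i, α i) × α k => Function.update q.1 k q.2) ⁻¹' Set.univ.pi s =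
      (Set.univ.pi (Function.update s k Set.univ)) ×ˢ s k := by
    ext q
    simp only [Set.mem_preimage, Set.mem_pi, Set.mem_univ, true_implies, Set.mem_prod]
    constructor
    · intro h
      refine ⟨fun i => ?_, by simpa using h k⟩
      rcases eq_or_ne i k with rfl | hik
      · simp
      · simpa [hik] using h i
    · rintro ⟨h, hk⟩ i
      rcases eq_or_ne i k with rfl | hik
      · simpa using hk
      · simpa [hik] using h i
  rw [this, Measure.prod_prod, Measure.pi_pi,
    ← Finset.prod_erase_mul _ _ (Finset.mem_univ k), ← Finset.prod_erase_mul _ (fun i => μ i (s i))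
      (Finset.mem_univ k)]
  simp only [Function.update_self, measure_univ, mul_one]
  congr 1
  refine Finset.prod_congr rfl fun i hi => ?_
  rw [Function.update_of_ne (Finset.ne_of_mem_erase hi)]

/-- Stein's identity for a standard Gaussian vector, in one coordinate. -/
theorem integral_eval_mul_stdGaussianPi {κ : Type*} [Fintype κ] [DecidableEq κ] (k : κ)
    {H H' : (κ → ℝ) → ℝ}
    (hd : ∀ x z, HasDerivAt (fun z => H (Function.update x k z)) (H' (Function.update x k z)) z)
    (hi : Integrable H (stdGaussianPi κ)) (hi' : Integrable H' (stdGaussianPi κ))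
    (hxi : Integrable (fun x => x k * H x) (stdGaussianPi κ)) :
    ∫ x, x k * H x ∂stdGaussianPi κ = ∫ x, H' x ∂stdGaussianPi κ := by
  have hmp : MeasurePreserving (fun q : (κ → ℝ) × ℝ => Function.update q.1 k q.2)
      ((stdGaussianPi κ).prod (gaussianReal 0 1)) (stdGaussianPi κ) :=
    measurePreserving_update_pi (fun _ : κ => gaussianReal 0 1) k
  have int : ∀ {f : (κ → ℝ) → ℝ}, Integrable f (stdGaussianPi κ) → Integrable (fun q : (κ → ℝ) × ℝ =>
      f (Function.update q.1 k q.2)) ((stdGaussianPi κ).prod (gaussianReal 0 1)) := by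
    intro f hf
    exact hmp.integrable_comp_of_integrable hf
  have eq : ∀ {f : (κ → ℝ) → ℝ}, Integrable f (stdGaussianPi κ) → ∫ x, f x ∂stdGaussianPi κ =
      ∫ x, ∫ z, f (Function.update x k z) ∂gaussianReal 0 1 ∂stdGaussianPi κ := by
    intro f hf
    rw [← integral_prod _ (int hf)]
    rw [← integral_map hmp.measurable.aemeasurable
      (by rw [hmp.map_eq]; exact hf.aestronglyMeasurable), hmp.map_eq]
  rw [eq hxi, eq hi']
  refine integral_congr_ae ?_
  filter_upwards [(int hi).prod_right_ae, (int hi').prod_right_ae, (int hxi).prod_right_ae]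
    with x h1 h2 h3
  simp only [Function.update_self] at h3 ⊢
  exact integral_id_mul_gaussianReal (hd x) h1 h2 h3

/-- Functions of exponential growth are integrable against the standard Gaussian measure. -/
theorem integrable_stdGaussianPi_of_le_exp {κ : Type*} [Fintype κ] {f : (κ → ℝ) → ℝ} (C K : ℝ)
    (hf : AEStronglyMeasurable f (stdGaussianPi κ))
    (hle : ∀ x, |f x| ≤ C * Real.exp (K * ∑ k, |x k|)) : Integrable f (stdGaussianPi κ) := by
  have h1 : Integrable (fun z : ℝ => Real.exp (K * |z|)) (gaussianReal 0 1) := by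
    refine ((integrable_exp_mul_gaussianReal K).add (integrable_exp_mul_gaussianReal (-K))).mono'
      (by fun_prop) (Filter.Eventually.of_forall fun z => ?_)
    rw [Real.norm_eq_abs, Real.abs_exp]
    rcases abs_cases z with ⟨h, _⟩ | ⟨h, _⟩ <;> rw [h] <;> simp only [Pi.add_apply]
    · linarith [Real.exp_pos (-K * z)]
    · rw [mul_neg, ← neg_mul]
      linarith [Real.exp_pos (K * z)]
  have h2 : Integrable (fun x : κ → ℝ => ∏ k, Real.exp (K * |x k|)) (stdGaussianPi κ) :=
    Integrable.fintype_prod (fun _ => h1)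
  refine (h2.const_mul C).mono' hf (Filter.Eventually.of_forall fun x => ?_)
  rw [Real.norm_eq_abs, ← Real.exp_sum, ← Finset.mul_sum]
  exact hle x

/-! ### Smooth maximum and its derivatives -/

/-- The softmax weights at inverse temperature `β`. -/
noncomputable def softmaxWeight {ι : Type*} [Fintype ι] (β : ℝ) (x : ι → ℝ) (i : ι) : ℝ :=
  Real.exp (β * x i) / ∑ j, Real.exp (β * x j)

/-- The normalized log-sum-exp function at inverse temperature `β`, a smooth maximum. -/
noncomputable def logSumExp {ι : Type*} [Fintype ι] (β : ℝ) (x : ι → ℝ) : ℝ :=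
  β⁻¹ * Real.log (∑ j, Real.exp (β * x j))

section Softmax

variable {ι : Type*} [Fintype ι] [Nonempty ι] {β : ℝ}

theorem sum_exp_pos (β : ℝ) (x : ι → ℝ) : 0 < ∑ j, Real.exp (β * x j) :=
  Finset.sum_pos (fun _ _ => Real.exp_pos _) Finset.univ_nonempty

omit [Nonempty ι] in
theorem softmaxWeight_nonneg (β : ℝ) (x : ι → ℝ) (i : ι) : 0 ≤ softmaxWeight β x i :=
  div_nonneg (Real.exp_pos _).le (Finset.sum_nonneg fun _ _ => (Real.exp_pos _).le)

theorem sum_softmaxWeight (β : ℝ) (x : ι → ℝ) : ∑ i, softmaxWeight β x i = 1 := by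
  simp only [softmaxWeight]
  rw [← Finset.sum_div, div_self (sum_exp_pos β x).ne']

theorem softmaxWeight_le_one (β : ℝ) (x : ι → ℝ) (i : ι) : softmaxWeight β x i ≤ 1 := by
  rw [← sum_softmaxWeight β x]
  exact Finset.single_le_sum (fun j _ => softmaxWeight_nonneg β x j) (Finset.mem_univ i)

theorem abs_sum_softmaxWeight_mul_le (β : ℝ) (x y : ι → ℝ) :
    |∑ i, softmaxWeight β x i * y i| ≤ ∑ i, |y i| := by
  refine (Finset.abs_sum_le_sum_abs _ _).trans (Finset.sum_le_sum fun i _ => ?_)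
  rw [abs_mul, abs_of_nonneg (softmaxWeight_nonneg β x i)]
  exact mul_le_of_le_one_left (abs_nonneg _) (softmaxWeight_le_one β x i)

@[fun_prop]
theorem continuous_softmaxWeight (β : ℝ) (i : ι) :
    Continuous fun x : ι → ℝ => softmaxWeight β x i := by
  unfold softmaxWeight
  exact Continuous.div (by fun_prop) (by fun_prop) fun x => (sum_exp_pos β x).ne'

@[fun_prop]
theorem continuous_logSumExp (β : ℝ) : Continuous fun x : ι → ℝ => logSumExp β x := by
  unfold logSumExp
  exact continuous_const.mul (Continuous.log (by fun_prop) fun x => (sum_exp_pos β x).ne')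

omit [Nonempty ι] in
theorem le_logSumExp (hβ : 0 < β) (x : ι → ℝ) (i : ι) : x i ≤ logSumExp β x := by
  unfold logSumExp
  rw [inv_mul_eq_div, le_div_iff₀ hβ, mul_comm, ← Real.log_exp (β * x i)]
  exact Real.log_le_log (Real.exp_pos _)
    (Finset.single_le_sum (f := fun j => Real.exp (β * x j)) (fun j _ => (Real.exp_pos _).le)
      (Finset.mem_univ i))

theorem logSumExp_le (hβ : 0 < β) {x : ι → ℝ} {M : ℝ} (hM : ∀ i, x i ≤ M) :
    logSumExp β x ≤ M + Real.log (Fintype.card ι) / β := by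
  have hc : (0 : ℝ) < Fintype.card ι := by exact_mod_cast Fintype.card_pos
  have h1 : ∑ j, Real.exp (β * x j) ≤ Fintype.card ι * Real.exp (β * M) := by
    refine (Finset.sum_le_card_nsmul _ _ (Real.exp (β * M)) fun i _ => ?_).trans_eq ?_
    · exact Real.exp_le_exp.2 (mul_le_mul_of_nonneg_left (hM i) hβ.le)
    · simp
  have h2 := Real.log_le_log (sum_exp_pos β x) h1
  rw [Real.log_mul hc.ne' (Real.exp_pos _).ne', Real.log_exp] at h2
  unfold logSumExp
  rw [inv_mul_eq_div, div_le_iff₀ hβ, add_mul, div_mul_cancel₀ _ hβ.ne']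
  linarith

theorem abs_logSumExp_le (hβ : 0 < β) (x : ι → ℝ) :
    |logSumExp β x| ≤ ∑ i, |x i| + Real.log (Fintype.card ι) / β := by
  have h : ∀ i, |x i| ≤ ∑ i, |x i| := fun i =>
    Finset.single_le_sum (f := fun j => |x j|) (fun j _ => abs_nonneg _) (Finset.mem_univ i)
  have hl : 0 ≤ Real.log (Fintype.card ι) / β :=
    div_nonneg (Real.log_natCast_nonneg _) hβ.le
  refine abs_le.2 ⟨?_, logSumExp_le hβ fun i => (le_abs_self _).trans (h i)⟩
  obtain ⟨i⟩ := ‹Nonempty ι›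
  have := le_logSumExp hβ x i
  have := neg_abs_le (x i)
  have := h i
  linarith

theorem HasDerivAt.logSumExp (hβ : 0 < β) {x : ℝ → ι → ℝ} {x' : ι → ℝ} {t : ℝ}
    (hx : ∀ i, HasDerivAt (fun s => x s i) (x' i) t) :
    HasDerivAt (fun s => logSumExp β (x s)) (∑ i, softmaxWeight β (x t) i * x' i) t := by
  have h1 : HasDerivAt (fun s => ∑ j, Real.exp (β * x s j))
      (∑ j, Real.exp (β * x t j) * (β * x' j)) t :=
    HasDerivAt.fun_sum fun j _ => ((hx j).const_mul β).exp
  have h2 := (h1.log (sum_exp_pos β (x t)).ne').const_mul β⁻¹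
  unfold _root_.logSumExp
  convert! h2 using 1
  rw [Finset.sum_div, Finset.mul_sum]
  refine Finset.sum_congr rfl fun i _ => ?_
  unfold softmaxWeight
  field_simp

theorem HasDerivAt.softmaxWeight {x : ℝ → ι → ℝ} {x' : ι → ℝ} {t : ℝ}
    (hx : ∀ i, HasDerivAt (fun s => x s i) (x' i) t) (i : ι) :
    HasDerivAt (fun s => softmaxWeight β (x s) i)
      (softmaxWeight β (x t) i * (β * (x' i - ∑ j, softmaxWeight β (x t) j * x' j))) t := by
  have h1 : HasDerivAt (fun s => ∑ j, Real.exp (β * x s j))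
      (∑ j, Real.exp (β * x t j) * (β * x' j)) t :=
    HasDerivAt.fun_sum fun j _ => ((hx j).const_mul β).exp
  have hpos := (sum_exp_pos β (x t)).ne'
  have h2 := (((hx i).const_mul β).exp).div h1 hpos
  have h3 : ∑ j, _root_.softmaxWeight β (x t) j * x' j =
      (∑ j, Real.exp (β * x t j) * x' j) / ∑ j, Real.exp (β * x t j) := by
    rw [Finset.sum_div]
    refine Finset.sum_congr rfl fun j _ => ?_
    unfold _root_.softmaxWeight
    ring
  have h4 : ∑ j, Real.exp (β * x t j) * (β * x' j) = β * ∑ j, Real.exp (β * x t j) * x' j := by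
    rw [Finset.mul_sum]
    exact Finset.sum_congr rfl fun j _ => by ring
  rw [h3]
  rw [h4] at h2
  unfold _root_.softmaxWeight
  convert! h2 using 1
  field_simp

end Softmax

/-! ### Integration by parts under an exponential tilt -/

section Interpolation

variable {ι τ : Type*} [Fintype ι] [Nonempty ι] [Fintype τ] {β : ℝ}

omit [Nonempty ι] in
theorem sum_abs_dotProduct_le (a : ι → τ → ℝ) (z : τ → ℝ) :
    ∑ i, |a i ⬝ᵥ z| ≤ (∑ i, ∑ k, |a i k|) * ∑ k, |z k| := by
  rw [Finset.sum_mul]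
  refine Finset.sum_le_sum fun i _ => (Finset.abs_sum_le_sum_abs _ _).trans ?_
  rw [Finset.sum_mul]
  refine Finset.sum_le_sum fun k _ => ?_
  rw [abs_mul]
  exact mul_le_mul_of_nonneg_left (Finset.single_le_sum (f := fun k => |z k|)
    (fun j _ => abs_nonneg _) (Finset.mem_univ k)) (abs_nonneg _)

/-- A smooth maximum of linear forms grows at most linearly, so a factor of linear growth times its
exponential is bounded by an exponential of the `ℓ₁` norm. Every integrand of the interpolation has
this shape. -/
theorem integrable_mul_exp_logSumExp (hβ : 0 < β) (l : ℝ) (a : ι → τ → ℝ) {f : (τ → ℝ) → ℝ}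
    (hf : Continuous f) {C : ℝ} (hC : ∀ z, |f z| ≤ C * (1 + ∑ k, |z k|)) :
    Integrable (fun z => f z * Real.exp (l * logSumExp β fun i => a i ⬝ᵥ z)) (stdGaussianPi τ) := by
  set L := Real.log (Fintype.card ι) / β
  set A := ∑ i, ∑ k, |a i k|
  have hC0 : 0 ≤ C := by
    have := (abs_nonneg _).trans (hC 0)
    simpa using this
  refine integrable_stdGaussianPi_of_le_exp (C * Real.exp (|l| * L)) (1 + |l| * A)
    (Continuous.aestronglyMeasurable (hf.mul ?_)) fun z => ?_
  · refine Real.continuous_exp.comp (continuous_const.mul ((continuous_logSumExp β).comp ?_))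
    simp only [dotProduct]
    fun_prop
  · rw [abs_mul, Real.abs_exp]
    have h1 : l * (logSumExp β fun i => a i ⬝ᵥ z) ≤ |l| * (A * ∑ k, |z k| + L) := by
      refine (le_abs_self _).trans ?_
      rw [abs_mul]
      exact mul_le_mul_of_nonneg_left ((abs_logSumExp_le hβ _).trans
        (by simpa [L] using sum_abs_dotProduct_le a z)) (abs_nonneg _)
    have h2 : |f z| ≤ C * Real.exp (∑ k, |z k|) := (hC z).trans
      (mul_le_mul_of_nonneg_left (by rw [add_comm]; exact Real.add_one_le_exp _) hC0)
    calc |f z| * Real.exp (l * logSumExp β fun i => a i ⬝ᵥ z)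
        ≤ (C * Real.exp (∑ k, |z k|)) * Real.exp (|l| * (A * ∑ k, |z k| + L)) :=
          mul_le_mul h2 (Real.exp_le_exp.2 h1) (Real.exp_pos _).le
            (mul_nonneg hC0 (Real.exp_pos _).le)
      _ = _ := by
          rw [mul_assoc, mul_assoc, ← Real.exp_add, ← Real.exp_add]
          ring_nf

end Interpolation

section Interpolation

variable {ι τ : Type*} [Fintype ι] [Nonempty ι] [Fintype τ] {β : ℝ}

omit [Fintype ι] [Nonempty ι] in
theorem hasDerivAt_dotProduct_update [DecidableEq τ] (a : ι → τ → ℝ) (x : τ → ℝ) (k : τ) (z : ℝ)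
    (i : ι) : HasDerivAt (fun z => a i ⬝ᵥ Function.update x k z) (a i k) z := by
  have h : ∀ j ∈ Finset.univ, HasDerivAt (fun z => a i j * Function.update x k z j)
      (a i j * if j = k then 1 else 0) z := by
    intro j _
    refine HasDerivAt.const_mul _ ?_
    rcases eq_or_ne j k with rfl | hj
    · simpa using hasDerivAt_id' z
    · simpa [hj] using hasDerivAt_const z (x j)
  simpa [dotProduct] using HasDerivAt.fun_sum h

omit [Fintype ι] [Nonempty ι] in
theorem continuous_dotProduct_right (a : ι → τ → ℝ) :
    Continuous fun z : τ → ℝ => fun i => a i ⬝ᵥ z := by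
  simp only [dotProduct]
  fun_prop

theorem abs_sub_sum_softmaxWeight_le (β : ℝ) (x y : ι → ℝ) (i : ι) :
    |y i - ∑ j, softmaxWeight β x j * y j| ≤ 2 * ∑ j, |y j| := by
  have h1 := abs_sum_softmaxWeight_mul_le β x y
  have h2 := Finset.single_le_sum (f := fun j => |y j|) (fun j _ => abs_nonneg _)
    (Finset.mem_univ i)
  have h3 := abs_sub (y i) (∑ j, softmaxWeight β x j * y j)
  linarith

theorem continuous_softmaxWeight_dotProduct (β : ℝ) (w : ι → τ → ℝ) (i : ι) :
    Continuous fun z : τ → ℝ => softmaxWeight β (fun j => w j ⬝ᵥ z) i :=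
  (continuous_softmaxWeight β i).comp (continuous_dotProduct_right w)

theorem integrable_eval_mul_softmaxWeight_mul_exp (hβ : 0 < β) (l : ℝ) (a w : ι → τ → ℝ) (i : ι)
    (k : τ) :
    Integrable (fun z => z k * (softmaxWeight β (fun j => w j ⬝ᵥ z) i *
      Real.exp (l * logSumExp β fun j => a j ⬝ᵥ z))) (stdGaussianPi τ) := by
  simp only [← mul_assoc]
  have := continuous_softmaxWeight_dotProduct β w i
  refine integrable_mul_exp_logSumExp hβ l a (C := 1) (by fun_prop) fun z => ?_
  rw [abs_mul, abs_of_nonneg (softmaxWeight_nonneg _ _ _)]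
  have h1 := Finset.single_le_sum (f := fun j => |z j|) (fun j _ => abs_nonneg _)
    (Finset.mem_univ k)
  have h2 := mul_le_of_le_one_right (abs_nonneg (z k))
    (softmaxWeight_le_one β (fun j => w j ⬝ᵥ z) i)
  linarith

theorem integrable_softmaxWeight_deriv_mul_exp (hβ : 0 < β) (l : ℝ) (a w : ι → τ → ℝ) (i : ι)
    (k : τ) :
    Integrable (fun z => softmaxWeight β (fun j => w j ⬝ᵥ z) i *
      (β * (w i k - ∑ j, softmaxWeight β (fun j => w j ⬝ᵥ z) j * w j k) +
        l * ∑ j, softmaxWeight β (fun j => a j ⬝ᵥ z) j * a j k) *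
      Real.exp (l * logSumExp β fun j => a j ⬝ᵥ z)) (stdGaussianPi τ) := by
  have hs0 : ∀ z : τ → ℝ, 0 ≤ ∑ k, |z k| := fun z => Finset.sum_nonneg fun _ _ => abs_nonneg _
  have hw := continuous_softmaxWeight_dotProduct β w
  have ha := continuous_softmaxWeight_dotProduct β a
  refine integrable_mul_exp_logSumExp hβ l a
    (C := |β| * (2 * ∑ j, |w j k|) + |l| * ∑ j, |a j k|) (by fun_prop) fun z => ?_
  rw [abs_mul, abs_of_nonneg (softmaxWeight_nonneg _ _ _)]
  have h1 : |β * (w i k - ∑ j, softmaxWeight β (fun j => w j ⬝ᵥ z) j * w j k) +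
        l * ∑ j, softmaxWeight β (fun j => a j ⬝ᵥ z) j * a j k| ≤
      |β| * (2 * ∑ j, |w j k|) + |l| * ∑ j, |a j k| := by
    refine (abs_add_le _ _).trans (add_le_add ?_ ?_)
    · rw [abs_mul]
      exact mul_le_mul_of_nonneg_left
        (abs_sub_sum_softmaxWeight_le β _ (fun j => w j k) i) (abs_nonneg _)
    · rw [abs_mul]
      exact mul_le_mul_of_nonneg_left (abs_sum_softmaxWeight_mul_le β _ (fun j => a j k))
        (abs_nonneg _)
  have h2 := (abs_nonneg _).trans h1
  calc _ ≤ 1 * (|β| * (2 * ∑ j, |w j k|) + |l| * ∑ j, |a j k|) :=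
        mul_le_mul (softmaxWeight_le_one _ _ _) h1 (abs_nonneg _) zero_le_one
    _ ≤ _ := by nlinarith [hs0 z]

/-- Gaussian integration by parts for one softmax weight, tilted by the exponential of a
smooth maximum. -/
theorem integral_eval_mul_softmaxWeight_mul_exp (hβ : 0 < β) (l : ℝ) (a w : ι → τ → ℝ) (i : ι)
    (k : τ) :
    ∫ z, z k * (softmaxWeight β (fun j => w j ⬝ᵥ z) i *
        Real.exp (l * logSumExp β fun j => a j ⬝ᵥ z)) ∂stdGaussianPi τ =
      ∫ z, softmaxWeight β (fun j => w j ⬝ᵥ z) i *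
        (β * (w i k - ∑ j, softmaxWeight β (fun j => w j ⬝ᵥ z) j * w j k) +
          l * ∑ j, softmaxWeight β (fun j => a j ⬝ᵥ z) j * a j k) *
        Real.exp (l * logSumExp β fun j => a j ⬝ᵥ z) ∂stdGaussianPi τ := by
  classical
  refine integral_eval_mul_stdGaussianPi k (fun x z => ?_) ?_
    (integrable_softmaxWeight_deriv_mul_exp hβ l a w i k)
    (integrable_eval_mul_softmaxWeight_mul_exp hβ l a w i k)
  · have h1 := HasDerivAt.softmaxWeight (β := β) (hasDerivAt_dotProduct_update w x k z) i
    have h2 := ((HasDerivAt.logSumExp hβ (hasDerivAt_dotProduct_update a x k z)).const_mul l).exp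
    convert! h1.mul h2 using 1
    ring
  · refine integrable_mul_exp_logSumExp hβ l a (C := 1)
      (continuous_softmaxWeight_dotProduct β w i) fun z => ?_
    rw [abs_of_nonneg (softmaxWeight_nonneg _ _ _)]
    have : 0 ≤ ∑ k, |z k| := Finset.sum_nonneg fun _ _ => abs_nonneg _
    linarith [softmaxWeight_le_one β (fun j => w j ⬝ᵥ z) i]

/-- Gaussian integration by parts for the gradient of a smooth maximum, tilted by the exponential
of another smooth maximum. -/
theorem integral_sum_softmaxWeight_mul_exp (hβ : 0 < β) (l : ℝ) (a w c : ι → τ → ℝ) :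
    ∫ z, (∑ i, softmaxWeight β (fun j => w j ⬝ᵥ z) i * (c i ⬝ᵥ z)) *
        Real.exp (l * logSumExp β fun j => a j ⬝ᵥ z) ∂stdGaussianPi τ =
      ∫ z, (∑ i, softmaxWeight β (fun j => w j ⬝ᵥ z) i *
        (β * (c i ⬝ᵥ w i - ∑ j, softmaxWeight β (fun j => w j ⬝ᵥ z) j * (c i ⬝ᵥ w j)) +
          l * ∑ j, softmaxWeight β (fun j => a j ⬝ᵥ z) j * (c i ⬝ᵥ a j))) *
        Real.exp (l * logSumExp β fun j => a j ⬝ᵥ z) ∂stdGaussianPi τ := by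
  have e1 : ∀ z : τ → ℝ, (∑ i, softmaxWeight β (fun j => w j ⬝ᵥ z) i * (c i ⬝ᵥ z)) *
        Real.exp (l * logSumExp β fun j => a j ⬝ᵥ z) =
      ∑ i, ∑ k, c i k * (z k * (softmaxWeight β (fun j => w j ⬝ᵥ z) i *
        Real.exp (l * logSumExp β fun j => a j ⬝ᵥ z))) := by
    intro z
    rw [Finset.sum_mul]
    refine Finset.sum_congr rfl fun i _ => ?_
    rw [dotProduct, Finset.mul_sum, Finset.sum_mul]
    exact Finset.sum_congr rfl fun k _ => by ring
  have e2 : ∀ z : τ → ℝ, (∑ i, softmaxWeight β (fun j => w j ⬝ᵥ z) i *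
        (β * (c i ⬝ᵥ w i - ∑ j, softmaxWeight β (fun j => w j ⬝ᵥ z) j * (c i ⬝ᵥ w j)) +
          l * ∑ j, softmaxWeight β (fun j => a j ⬝ᵥ z) j * (c i ⬝ᵥ a j))) *
        Real.exp (l * logSumExp β fun j => a j ⬝ᵥ z) =
      ∑ i, ∑ k, c i k * (softmaxWeight β (fun j => w j ⬝ᵥ z) i *
        (β * (w i k - ∑ j, softmaxWeight β (fun j => w j ⬝ᵥ z) j * w j k) +
          l * ∑ j, softmaxWeight β (fun j => a j ⬝ᵥ z) j * a j k) *
        Real.exp (l * logSumExp β fun j => a j ⬝ᵥ z)) := by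
    intro z
    have hsw : ∀ (i : ι) (p : ι → ℝ) (b : ι → τ → ℝ),
        ∑ j, p j * (c i ⬝ᵥ b j) = ∑ k, c i k * ∑ j, p j * b j k := by
      intro i p b
      simp only [dotProduct, Finset.mul_sum]
      rw [Finset.sum_comm]
      exact Finset.sum_congr rfl fun k _ => Finset.sum_congr rfl fun j _ => by ring
    rw [Finset.sum_mul]
    refine Finset.sum_congr rfl fun i _ => ?_
    rw [hsw, hsw, dotProduct, ← Finset.sum_sub_distrib, Finset.mul_sum, Finset.mul_sum,
      ← Finset.sum_add_distrib, Finset.mul_sum, Finset.sum_mul]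
    exact Finset.sum_congr rfl fun k _ => by ring
  have i1 := fun i k => (integrable_eval_mul_softmaxWeight_mul_exp hβ l a w i k).const_mul (c i k)
  have i2 := fun i k => (integrable_softmaxWeight_deriv_mul_exp hβ l a w i k).const_mul (c i k)
  simp only [e1, e2]
  rw [integral_finsetSum _ fun i _ => integrable_finsetSum _ fun k _ => i1 i k,
    integral_finsetSum _ fun i _ => integrable_finsetSum _ fun k _ => i2 i k]
  refine Finset.sum_congr rfl fun i _ => ?_
  rw [integral_finsetSum _ fun k _ => i1 i k, integral_finsetSum _ fun k _ => i2 i k]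
  refine Finset.sum_congr rfl fun k _ => ?_
  rw [integral_const_mul, integral_const_mul, integral_eval_mul_softmaxWeight_mul_exp hβ]

end Interpolation

/-! ### Interpolation between two Gaussian processes -/

section Interpolation

variable {ι τ : Type*} [Fintype ι] [Nonempty ι] [Fintype τ] {β : ℝ}

/-- Only the first factor rotates; the tilt keeps the process `a`. Since sine and cosine are bounded
by 1, one dominating function serves all angles. -/
theorem hasDerivAt_integral_logSumExp_mul_exp (hβ : 0 < β) (l : ℝ) (a b : ι → τ → ℝ) (θ : ℝ) :
    HasDerivAt (fun θ => ∫ z, logSumExp β (fun i => (Real.sin θ • a i + Real.cos θ • b i) ⬝ᵥ z) *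
        Real.exp (l * logSumExp β fun j => a j ⬝ᵥ z) ∂stdGaussianPi τ)
      (∫ z, (∑ i, softmaxWeight β (fun i => (Real.sin θ • a i + Real.cos θ • b i) ⬝ᵥ z) i *
        ((Real.cos θ • a i - Real.sin θ • b i) ⬝ᵥ z)) *
        Real.exp (l * logSumExp β fun j => a j ⬝ᵥ z) ∂stdGaussianPi τ) θ := by
  have hs0 : ∀ z : τ → ℝ, 0 ≤ ∑ k, |z k| := fun z => Finset.sum_nonneg fun _ _ => abs_nonneg _
  set B := ∑ i, ∑ k, (|a i k| + |b i k|) with hB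
  have hle : ∀ s c : ℝ, |s| ≤ 1 → |c| ≤ 1 →
      ∑ i, ∑ k, |(s • a i + c • b i) k| ≤ B := by
    intro s c hs hc
    refine Finset.sum_le_sum fun i _ => Finset.sum_le_sum fun k _ => (abs_add_le _ _).trans ?_
    simp only [Pi.smul_apply, smul_eq_mul, abs_mul]
    exact add_le_add (mul_le_of_le_one_left (abs_nonneg _) hs)
      (mul_le_of_le_one_left (abs_nonneg _) hc)
  have hB0 : 0 ≤ B := Finset.sum_nonneg fun _ _ => Finset.sum_nonneg fun _ _ => by positivity
  have hcE := (continuous_logSumExp β).comp (continuous_dotProduct_right a)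
  have hcE' : Continuous fun z : τ → ℝ => Real.exp (l * logSumExp β fun j => a j ⬝ᵥ z) :=
    Real.continuous_exp.comp (continuous_const.mul hcE)
  have hcF : ∀ θ : ℝ, Continuous fun z : τ → ℝ =>
      logSumExp β (fun i => (Real.sin θ • a i + Real.cos θ • b i) ⬝ᵥ z) := fun θ =>
    (continuous_logSumExp β).comp
      (continuous_dotProduct_right fun i => Real.sin θ • a i + Real.cos θ • b i)
  have hcF' : Continuous fun z : τ → ℝ =>
      ∑ i, softmaxWeight β (fun i => (Real.sin θ • a i + Real.cos θ • b i) ⬝ᵥ z) i *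
        ((Real.cos θ • a i - Real.sin θ • b i) ⬝ᵥ z) := by
    refine continuous_finsetSum _ fun i _ => Continuous.mul
      (continuous_softmaxWeight_dotProduct β (fun i => Real.sin θ • a i + Real.cos θ • b i) i) ?_
    exact (continuous_apply i).comp
      (continuous_dotProduct_right fun i => Real.cos θ • a i - Real.sin θ • b i)
  refine (hasDerivAt_integral_of_dominated_loc_of_deriv_le
    (F := fun θ z => logSumExp β (fun i => (Real.sin θ • a i + Real.cos θ • b i) ⬝ᵥ z) *
        Real.exp (l * logSumExp β fun j => a j ⬝ᵥ z))
    (F' := fun θ z => (∑ i, softmaxWeight β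
        (fun i => (Real.sin θ • a i + Real.cos θ • b i) ⬝ᵥ z) i *
        ((Real.cos θ • a i - Real.sin θ • b i) ⬝ᵥ z)) *
        Real.exp (l * logSumExp β fun j => a j ⬝ᵥ z))
    (bound := fun z => (B * ∑ k, |z k|) * Real.exp (l * logSumExp β fun j => a j ⬝ᵥ z))
    (s := Set.univ) Filter.univ_mem ?_ ?_ ?_ ?_ ?_ ?_).2
  · exact Filter.Eventually.of_forall fun θ => ((hcF θ).mul hcE').aestronglyMeasurable
  · refine integrable_mul_exp_logSumExp hβ l a
      (C := B + Real.log (Fintype.card ι) / β) (hcF θ) fun z => ?_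
    refine (abs_logSumExp_le hβ _).trans ?_
    have h1 := sum_abs_dotProduct_le (fun i => Real.sin θ • a i + Real.cos θ • b i) z
    have h2 := hle _ _ (Real.abs_sin_le_one θ) (Real.abs_cos_le_one θ)
    have h3 := mul_le_mul_of_nonneg_right h2 (hs0 z)
    have h4 : 0 ≤ Real.log (Fintype.card ι) / β :=
      div_nonneg (Real.log_natCast_nonneg _) hβ.le
    nlinarith [hs0 z, mul_nonneg h4 (hs0 z)]
  · exact (hcF'.mul hcE').aestronglyMeasurable
  · refine Filter.Eventually.of_forall fun z x _ => ?_
    rw [norm_mul, Real.norm_eq_abs, Real.norm_eq_abs, Real.abs_exp]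
    refine mul_le_mul_of_nonneg_right ((abs_sum_softmaxWeight_mul_le β _ _).trans ?_)
      (Real.exp_pos _).le
    refine (sum_abs_dotProduct_le (fun i => Real.cos x • a i - Real.sin x • b i) z).trans
      (mul_le_mul_of_nonneg_right ?_ (hs0 z))
    have := hle (Real.cos x) (-Real.sin x) (Real.abs_cos_le_one x)
      (by rw [abs_neg]; exact Real.abs_sin_le_one x)
    simpa [sub_eq_add_neg] using this
  · refine integrable_mul_exp_logSumExp hβ l a (C := B) (by fun_prop) fun z => ?_
    rw [abs_of_nonneg (mul_nonneg hB0 (hs0 z))]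
    nlinarith [hs0 z]
  · refine Filter.Eventually.of_forall fun z x _ => HasDerivAt.mul_const ?_ _
    refine HasDerivAt.logSumExp hβ fun i => ?_
    have h1 := ((Real.hasDerivAt_sin x).mul_const (a i ⬝ᵥ z)).add
      ((Real.hasDerivAt_cos x).mul_const (b i ⬝ᵥ z))
    simp only [add_dotProduct, smul_dotProduct, sub_dotProduct, smul_eq_mul]
    convert! h1 using 1
    ring

omit [Nonempty ι] in
/-- The Hessian of a smooth maximum is nonpositive against a matrix with negative increments. -/
theorem sum_mul_sub_sum_nonpos {p : ι → ℝ} (hp : ∀ i, 0 ≤ p i) (hp1 : ∑ i, p i = 1)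
    {D : ι → ι → ℝ} (hinc : ∀ i j, D i i + D j j - 2 * D i j ≤ 0) :
    ∑ i, p i * (D i i - ∑ j, p j * D i j) ≤ 0 := by
  -- Symmetrizing in `i` and `j` turns the expression into an average of increments.
  have e : ∑ i, p i * (D i i - ∑ j, p j * D i j) =
      (1 / 2) * ∑ i, ∑ j, p i * p j * (D i i + D j j - 2 * D i j) := by
    have h1 : ∑ i, ∑ j, p i * p j * D i i = ∑ i, p i * D i i := by
      refine Finset.sum_congr rfl fun i _ => ?_
      rw [← Finset.sum_mul, ← Finset.mul_sum, hp1, mul_one]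
    have h2 : ∑ i, ∑ j, p i * p j * D j j = ∑ i, p i * D i i := by
      rw [Finset.sum_comm, ← h1]
      exact Finset.sum_congr rfl fun i _ => Finset.sum_congr rfl fun j _ => by ring
    have h3 : ∑ i, ∑ j, p i * p j * (D i i + D j j - 2 * D i j) =
        ∑ i, ∑ j, p i * p j * D i i + ∑ i, ∑ j, p i * p j * D j j
          - 2 * ∑ i, ∑ j, p i * p j * D i j := by
      simp only [Finset.mul_sum, ← Finset.sum_add_distrib, ← Finset.sum_sub_distrib]
      exact Finset.sum_congr rfl fun i _ => Finset.sum_congr rfl fun j _ => by ring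
    have h4 : ∑ i, p i * (D i i - ∑ j, p j * D i j) =
        ∑ i, p i * D i i - ∑ i, ∑ j, p i * p j * D i j := by
      simp only [mul_sub, Finset.sum_sub_distrib, Finset.mul_sum, mul_assoc]
    rw [h3, h1, h2, h4]
    ring
  rw [e]
  refine mul_nonpos_of_nonneg_of_nonpos (by norm_num) (Finset.sum_nonpos fun i _ =>
    Finset.sum_nonpos fun j _ => mul_nonpos_of_nonneg_of_nonpos (mul_nonneg (hp i) (hp j)) (hinc i j))

theorem integrable_exp_logSumExp (hβ : 0 < β) (l : ℝ) (a : ι → τ → ℝ) :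
    Integrable (fun z => Real.exp (l * logSumExp β fun j => a j ⬝ᵥ z)) (stdGaussianPi τ) := by
  simpa using integrable_mul_exp_logSumExp hβ l a (f := fun _ => 1) (C := 1) (by fun_prop)
    fun z => by
      have : 0 ≤ ∑ k, |z k| := Finset.sum_nonneg fun _ _ => abs_nonneg _
      simpa using this

/-- Integration by parts yields two terms. The Hessian of the smooth maximum is paired with `s c (⟨a
i, a j⟩ - ⟨b i, b j⟩)`, which is nonpositive by comparison of increments. The derivative of the tilt
contributes `l c` times an average of `⟨a i, a j⟩ ≤ 1`; the process `b` drops out of it by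
orthogonality. -/
theorem integral_softmaxWeight_interpolation_le (hβ : 0 < β) {l : ℝ} (hl : 0 ≤ l)
    {a b : ι → τ → ℝ} (ha : ∀ i j, a i ⬝ᵥ a j ≤ 1) (hab : ∀ i j, a i ⬝ᵥ b j = 0)
    (hinc : ∀ i j, a i ⬝ᵥ a i + a j ⬝ᵥ a j - 2 * (a i ⬝ᵥ a j) ≤
      b i ⬝ᵥ b i + b j ⬝ᵥ b j - 2 * (b i ⬝ᵥ b j)) {s c : ℝ} (hs : 0 ≤ s) (hc : 0 ≤ c) :
    ∫ z, (∑ i, softmaxWeight β (fun i => (s • a i + c • b i) ⬝ᵥ z) i *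
        ((c • a i - s • b i) ⬝ᵥ z)) *
        Real.exp (l * logSumExp β fun j => a j ⬝ᵥ z) ∂stdGaussianPi τ ≤
      l * c * ∫ z, Real.exp (l * logSumExp β fun j => a j ⬝ᵥ z) ∂stdGaussianPi τ := by
  have hba : ∀ i j, b i ⬝ᵥ a j = 0 := fun i j => by rw [dotProduct_comm, hab]
  rw [integral_sum_softmaxWeight_mul_exp hβ l a (fun i => s • a i + c • b i)
    (fun i => c • a i - s • b i), ← integral_const_mul]
  have hint := (integrable_exp_logSumExp hβ l a).const_mul (l * c)
  have hnn : 0 ≤ ∫ z, l * c * Real.exp (l * logSumExp β fun j => a j ⬝ᵥ z) ∂stdGaussianPi τ :=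
    integral_nonneg fun z => by positivity
  -- If the integrand were not integrable its integral would be 0 by convention, and the right side
  -- is nonnegative.
  refine (em (Integrable _ _)).elim (fun h => integral_mono h hint fun z => ?_)
    fun h => (integral_undef h).trans_le hnn
  refine mul_le_mul_of_nonneg_right ?_ (Real.exp_pos _).le
  have hD : ∀ i j, (c • a i - s • b i) ⬝ᵥ (s • a j + c • b j) =
      s * c * (a i ⬝ᵥ a j - b i ⬝ᵥ b j) := by
    intro i j
    simp only [sub_dotProduct, dotProduct_add, smul_dotProduct, dotProduct_smul, smul_eq_mul,
      hab, hba]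
    ring
  have hA : ∀ i j, (c • a i - s • b i) ⬝ᵥ a j = c * (a i ⬝ᵥ a j) := by
    intro i j
    simp only [sub_dotProduct, smul_dotProduct, smul_eq_mul, hba]
    ring
  set p := softmaxWeight β (fun i => (s • a i + c • b i) ⬝ᵥ z)
  set q := softmaxWeight β (fun j => a j ⬝ᵥ z)
  have hp0 : ∀ i, 0 ≤ p i := softmaxWeight_nonneg _ _
  have hq0 : ∀ i, 0 ≤ q i := softmaxWeight_nonneg _ _
  have hp1 : ∑ i, p i = 1 := sum_softmaxWeight _ _
  have hq1 : ∑ i, q i = 1 := sum_softmaxWeight _ _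
  simp only [hD, hA]
  have h1 := sum_mul_sub_sum_nonpos hp0 hp1 (D := fun i j => s * c * (a i ⬝ᵥ a j - b i ⬝ᵥ b j))
    fun i j => by nlinarith [hinc i j, mul_nonneg hs hc]
  have h2 : ∀ i, ∑ j, q j * (c * (a i ⬝ᵥ a j)) ≤ c := by
    intro i
    calc _ ≤ ∑ j, q j * (c * 1) := Finset.sum_le_sum fun j _ =>
          mul_le_mul_of_nonneg_left (mul_le_mul_of_nonneg_left (ha i j) hc) (hq0 j)
      _ = c := by rw [← Finset.sum_mul, hq1]; ring
  have h3 : ∑ i, p i * (l * ∑ j, q j * (c * (a i ⬝ᵥ a j))) ≤ l * c := by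
    calc _ ≤ ∑ i, p i * (l * c) := Finset.sum_le_sum fun i _ =>
          mul_le_mul_of_nonneg_left (mul_le_mul_of_nonneg_left (h2 i) hl) (hp0 i)
      _ = l * c := by rw [← Finset.sum_mul, hp1, one_mul]
  have h4 : ∀ x y : ι → ℝ, ∑ i, p i * (β * x i + y i) =
      β * ∑ i, p i * x i + ∑ i, p i * y i := by
    intro x y
    rw [Finset.mul_sum, ← Finset.sum_add_distrib]
    exact Finset.sum_congr rfl fun i _ => by ring
  rw [h4]
  have := mul_nonpos_of_nonneg_of_nonpos hβ.le h1
  linarith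

/-- Gaussian comparison: the tilted mean of a smooth maximum of a process is controlled by the
mean of the smooth maximum of an uncorrelated process with larger increments. -/
theorem integral_logSumExp_mul_exp_le (hβ : 0 < β) {l : ℝ} (hl : 0 ≤ l)
    {a b : ι → τ → ℝ} (ha : ∀ i j, a i ⬝ᵥ a j ≤ 1) (hab : ∀ i j, a i ⬝ᵥ b j = 0)
    (hinc : ∀ i j, a i ⬝ᵥ a i + a j ⬝ᵥ a j - 2 * (a i ⬝ᵥ a j) ≤
      b i ⬝ᵥ b i + b j ⬝ᵥ b j - 2 * (b i ⬝ᵥ b j)) :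
    ∫ z, logSumExp β (fun i => a i ⬝ᵥ z) *
        Real.exp (l * logSumExp β fun j => a j ⬝ᵥ z) ∂stdGaussianPi τ ≤
      ∫ z, logSumExp β (fun i => b i ⬝ᵥ z) *
        Real.exp (l * logSumExp β fun j => a j ⬝ᵥ z) ∂stdGaussianPi τ +
      l * ∫ z, Real.exp (l * logSumExp β fun j => a j ⬝ᵥ z) ∂stdGaussianPi τ := by
  set M := ∫ z, Real.exp (l * logSumExp β fun j => a j ⬝ᵥ z) ∂stdGaussianPi τ
  -- The derivative is at most `l M cos θ`, so subtracting `l M sin θ` makes the function decreasing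
  -- from `θ = 0` (process `b`) to `θ = π / 2` (process `a`).
  have hd := fun θ => (hasDerivAt_integral_logSumExp_mul_exp hβ l a b θ).sub
    ((Real.hasDerivAt_sin θ).const_mul (l * M))
  have hanti := antitoneOn_of_deriv_nonpos (convex_Icc 0 (Real.pi / 2))
    (fun θ _ => (hd θ).continuousAt.continuousWithinAt)
    (fun θ _ => (hd θ).differentiableAt.differentiableWithinAt) fun θ hθ => by
      rw [(hd θ).deriv]
      rw [interior_Icc] at hθ
      have := integral_softmaxWeight_interpolation_le hβ hl ha hab hinc
        (Real.sin_nonneg_of_nonneg_of_le_pi hθ.1.le (by linarith [hθ.2, Real.pi_pos]))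
        (Real.cos_nonneg_of_neg_pi_div_two_le_of_le (by linarith [hθ.1, Real.pi_pos]) hθ.2.le)
      linarith
  have h := hanti (Set.left_mem_Icc.2 (by positivity)) (Set.right_mem_Icc.2 (by positivity))
    (by positivity)
  simp only [Pi.sub_apply, Real.sin_zero, Real.cos_zero, Real.sin_pi_div_two, Real.cos_pi_div_two,
    zero_smul, one_smul, zero_add, add_zero, mul_zero, mul_one, sub_zero] at h
  linarith

end Interpolation

/-! ### From comparison to sub-Gaussian tails -/

section Comparison

theorem integral_stdGaussianPi_sum_mul {κ κ' : Type*} [Fintype κ] [Fintype κ']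
    (f : (κ → ℝ) → ℝ) (g : (κ' → ℝ) → ℝ) :
    ∫ z, f (fun k => z (Sum.inl k)) * g (fun k => z (Sum.inr k)) ∂stdGaussianPi (κ ⊕ κ') =
      (∫ x, f x ∂stdGaussianPi κ) * ∫ y, g y ∂stdGaussianPi κ' := by
  have h := measurePreserving_sumPiEquivProdPi (fun _ : κ ⊕ κ' => gaussianReal 0 1)
  rw [← integral_prod_mul, ← h.integral_comp' (g := fun q => f q.1 * g q.2)]
  rfl

variable {ι κ κ' : Type*} [Fintype ι] [Nonempty ι] [Fintype κ] [Fintype κ'] {β : ℝ}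
  {a : ι → κ → ℝ} {b : ι → κ' → ℝ}

theorem integral_logSumExp_mul_exp_le_mul (hβ : 0 < β) {l : ℝ} (hl : 0 ≤ l)
    (ha : ∀ i j, a i ⬝ᵥ a j ≤ 1)
    (hinc : ∀ i j, a i ⬝ᵥ a i + a j ⬝ᵥ a j - 2 * (a i ⬝ᵥ a j) ≤
      b i ⬝ᵥ b i + b j ⬝ᵥ b j - 2 * (b i ⬝ᵥ b j)) :
    ∫ x, logSumExp β (fun i => a i ⬝ᵥ x) *
        Real.exp (l * logSumExp β fun j => a j ⬝ᵥ x) ∂stdGaussianPi κ ≤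
      (∫ y, logSumExp β (fun i => b i ⬝ᵥ y) ∂stdGaussianPi κ' + l) *
      ∫ x, Real.exp (l * logSumExp β fun j => a j ⬝ᵥ x) ∂stdGaussianPi κ := by
  -- Placing `a` and `b` on disjoint coordinates makes the processes independent, and the tilted
  -- mean of the `b` process factors.
  have h := integral_logSumExp_mul_exp_le hβ hl (a := fun i => Sum.elim (a i) (0 : κ' → ℝ))
    (b := fun i => Sum.elim (0 : κ → ℝ) (b i)) (by simpa [dotProduct] using ha)
    (by simp [dotProduct]) (by simpa [dotProduct] using hinc)
  have e1 : ∀ (u : κ → ℝ) (v : κ' → ℝ) (z : κ ⊕ κ' → ℝ),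
      Sum.elim u v ⬝ᵥ z = u ⬝ᵥ (fun k => z (Sum.inl k)) + v ⬝ᵥ (fun k => z (Sum.inr k)) := by
    intro u v z
    simp [dotProduct]
  simp only [e1, zero_dotProduct, add_zero, zero_add] at h
  have i1 := integral_stdGaussianPi_sum_mul (κ := κ) (κ' := κ') (fun x =>
    logSumExp β (fun i => a i ⬝ᵥ x) * Real.exp (l * logSumExp β fun j => a j ⬝ᵥ x)) (fun _ => 1)
  have i2 := integral_stdGaussianPi_sum_mul (κ := κ) (κ' := κ') (fun x =>
    Real.exp (l * logSumExp β fun j => a j ⬝ᵥ x)) (fun _ => 1)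
  have i3 := integral_stdGaussianPi_sum_mul (κ := κ) (κ' := κ') (fun x =>
    Real.exp (l * logSumExp β fun j => a j ⬝ᵥ x)) (fun y => logSumExp β (fun i => b i ⬝ᵥ y))
  simp only [mul_one, integral_const, probReal_univ, smul_eq_mul] at i1 i2
  simp only [mul_comm (Real.exp _)] at i3
  rw [i1, i2, i3] at h
  linarith

/-- The tilted comparison reads `M' ≤ (m + l) M` for the moment generating function `M`, so `M(l)
exp(-(l m + l² / 2))` decreases from its value 1 at `l = 0`. -/
theorem integral_exp_logSumExp_le (hβ : 0 < β) {l : ℝ} (hl : 0 ≤ l)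
    (ha : ∀ i j, a i ⬝ᵥ a j ≤ 1)
    (hinc : ∀ i j, a i ⬝ᵥ a i + a j ⬝ᵥ a j - 2 * (a i ⬝ᵥ a j) ≤
      b i ⬝ᵥ b i + b j ⬝ᵥ b j - 2 * (b i ⬝ᵥ b j)) :
    ∫ x, Real.exp (l * logSumExp β fun j => a j ⬝ᵥ x) ∂stdGaussianPi κ ≤
      Real.exp (l * ∫ y, logSumExp β (fun i => b i ⬝ᵥ y) ∂stdGaussianPi κ' + l ^ 2 / 2) := by
  set F : (κ → ℝ) → ℝ := fun x => logSumExp β fun j => a j ⬝ᵥ x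
  set m := ∫ y, logSumExp β (fun i => b i ⬝ᵥ y) ∂stdGaussianPi κ'
  have hset : integrableExpSet F (stdGaussianPi κ) = Set.univ :=
    Set.eq_univ_of_forall fun l => integrable_exp_logSumExp hβ l a
  have hd : ∀ l : ℝ, HasDerivAt (mgf F (stdGaussianPi κ))
      (∫ x, F x * Real.exp (l * F x) ∂stdGaussianPi κ) l := fun l =>
    hasDerivAt_mgf (by rw [hset]; simp)
  have he : ∀ l : ℝ, HasDerivAt (fun l => Real.exp (-(l * m + l ^ 2 / 2)))
      (Real.exp (-(l * m + l ^ 2 / 2)) * (-(m + l))) l := by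
    intro l
    have h1 : HasDerivAt (fun l : ℝ => -(l * m + l ^ 2 / 2)) (-(m + l)) l := by
      have := (((hasDerivAt_id' l).mul_const m).add (((hasDerivAt_id' l).pow 2).div_const 2)).neg
      convert! this using 1
      simp
    exact h1.exp
  have hg := fun l => (hd l).mul (he l)
  have hanti := antitoneOn_of_deriv_nonpos (convex_Icc 0 l)
    (fun θ _ => (hg θ).continuousAt.continuousWithinAt)
    (fun θ _ => (hg θ).differentiableAt.differentiableWithinAt) fun θ hθ => by
      rw [(hg θ).deriv]
      rw [interior_Icc] at hθ
      have h1 := integral_logSumExp_mul_exp_le_mul hβ hθ.1.le ha hinc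
      have h2 := mul_le_mul_of_nonneg_right h1 (Real.exp_pos (-(θ * m + θ ^ 2 / 2))).le
      have h3 : mgf F (stdGaussianPi κ) θ = ∫ x, Real.exp (θ * F x) ∂stdGaussianPi κ := rfl
      rw [h3]
      linarith
  have h := hanti (Set.left_mem_Icc.2 hl) (Set.right_mem_Icc.2 hl) hl
  simp only [Pi.mul_apply, mgf_zero, zero_mul, ne_eq, OfNat.ofNat_ne_zero, not_false_eq_true,
    zero_pow, zero_div, add_zero, Real.exp_zero, inv_one, mul_one, Real.exp_neg] at h
  rw [← div_eq_mul_inv, div_le_one (Real.exp_pos _)] at h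
  exact h

/-- Gaussian comparison and concentration: the deviations of the maximum of a process above the
mean of the maximum of a process with larger increments are sub-Gaussian. -/
theorem measureReal_exists_le_dotProduct_le (ha : ∀ i j, a i ⬝ᵥ a j ≤ 1)
    (hinc : ∀ i j, a i ⬝ᵥ a i + a j ⬝ᵥ a j - 2 * (a i ⬝ᵥ a j) ≤
      b i ⬝ᵥ b i + b j ⬝ᵥ b j - 2 * (b i ⬝ᵥ b j))
    {G : (κ' → ℝ) → ℝ} (hG : Integrable G (stdGaussianPi κ')) (hbG : ∀ y i, b i ⬝ᵥ y ≤ G y)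
    {m t : ℝ} (hm : ∫ y, G y ∂stdGaussianPi κ' ≤ m) (ht : 0 ≤ t) :
    (stdGaussianPi κ).real {x | ∃ i, m + t ≤ a i ⬝ᵥ x} ≤ Real.exp (-t ^ 2 / 2) := by
  have key : ∀ β : ℝ, 0 < β → (stdGaussianPi κ).real {x | ∃ i, m + t ≤ a i ⬝ᵥ x} ≤
      Real.exp (-t ^ 2 / 2 + t * (Real.log (Fintype.card ι) / β)) := by
    intro β hβ
    have h1 : ∫ y, logSumExp β (fun i => b i ⬝ᵥ y) ∂stdGaussianPi κ' ≤
        m + Real.log (Fintype.card ι) / β := by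
      have hle : ∀ y, logSumExp β (fun i => b i ⬝ᵥ y) ≤ G y + Real.log (Fintype.card ι) / β :=
        fun y => logSumExp_le hβ (hbG y)
      have hint : Integrable (fun y => logSumExp β (fun i => b i ⬝ᵥ y)) (stdGaussianPi κ') := by
        -- The parameter `l = 0` removes the tilt.
        have := integrable_mul_exp_logSumExp hβ 0 b
          (f := fun y => logSumExp β (fun i => b i ⬝ᵥ y))
          ((continuous_logSumExp β).comp (continuous_dotProduct_right b))
          (C := (∑ i, ∑ k, |b i k|) + Real.log (Fintype.card ι) / β) fun z => by
            have h1 := abs_logSumExp_le hβ fun i => b i ⬝ᵥ z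
            have h2 := sum_abs_dotProduct_le b z
            have h3 : 0 ≤ Real.log (Fintype.card ι) / β :=
              div_nonneg (Real.log_natCast_nonneg _) hβ.le
            have h4 : 0 ≤ ∑ k, |z k| := Finset.sum_nonneg fun _ _ => abs_nonneg _
            have h5 : 0 ≤ ∑ i, ∑ k, |b i k| :=
              Finset.sum_nonneg fun _ _ => Finset.sum_nonneg fun _ _ => abs_nonneg _
            nlinarith [mul_nonneg h3 h4]
        simpa using this
      refine (integral_mono hint (hG.add (integrable_const _)) hle).trans ?_
      simp only [Pi.add_apply]
      rw [integral_add hG (integrable_const _)]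
      simpa using hm
    have h2 := integral_exp_logSumExp_le hβ ht ha hinc
    have h3 : (stdGaussianPi κ).real {x | ∃ i, m + t ≤ a i ⬝ᵥ x} ≤
        (stdGaussianPi κ).real {x | m + t ≤ logSumExp β fun j => a j ⬝ᵥ x} :=
      measureReal_mono fun x ⟨i, hi⟩ => hi.trans (le_logSumExp hβ (fun j => a j ⬝ᵥ x) i)
    have h4 := measure_ge_le_exp_mul_mgf (μ := stdGaussianPi κ) (m + t) ht
      (integrable_exp_logSumExp hβ t a)
    refine h3.trans (h4.trans ((mul_le_mul_of_nonneg_left h2 (Real.exp_pos _).le).trans ?_))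
    rw [← Real.exp_add, Real.exp_le_exp]
    nlinarith [mul_le_mul_of_nonneg_left h1 ht]
  -- The smoothing error `log (card ι) / β` vanishes as `β` tends to infinity, so no trace of the
  -- cardinality remains.
  have hlim : Filter.Tendsto (fun β : ℝ => Real.exp (-t ^ 2 / 2 +
      t * (Real.log (Fintype.card ι) / β))) Filter.atTop (nhds (Real.exp (-t ^ 2 / 2 + t * 0))) :=
    (Real.continuous_exp.tendsto _).comp
      (((Filter.Tendsto.const_div_atTop Filter.tendsto_id _).const_mul t).const_add _)
  rw [mul_zero, add_zero] at hlim
  exact ge_of_tendsto hlim (Filter.eventually_gt_atTop 0 |>.mono key)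

end Comparison

/-! ### Gaussian widths and Chevet's inequality -/

section Width

variable {k : ℕ}

theorem l1Norm_nonneg (x : EuclideanSpace ℝ (Fin k)) : 0 ≤ l1Norm x :=
  Finset.sum_nonneg fun _ _ => abs_nonneg _

theorem l1Norm_smul (c : ℝ) (x : EuclideanSpace ℝ (Fin k)) : l1Norm (c • x) = |c| * l1Norm x := by
  simp [l1Norm, abs_mul, Finset.mul_sum]

theorem eq_zero_of_l1Norm_le_zero {x : EuclideanSpace ℝ (Fin k)} (h : l1Norm x ≤ 0) : x = 0 := by
  have h0 := (Finset.sum_eq_zero_iff_of_nonneg fun i _ => abs_nonneg (x i)).1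
    (le_antisymm h (l1Norm_nonneg x))
  ext i
  simpa using h0 i (Finset.mem_univ i)

theorem zero_mem_unitBall1 : (0 : EuclideanSpace ℝ (Fin k)) ∈ unitBall1 k := by
  simp [unitBall1, l1Norm]

theorem mem_smul_unitBall1 {x : EuclideanSpace ℝ (Fin k)} {c : ℝ} (h : l1Norm x ≤ c) :
    x ∈ c • unitBall1 k := by
  rcases ((l1Norm_nonneg x).trans h).eq_or_lt with rfl | hc
  · exact ⟨0, zero_mem_unitBall1, by simp [eq_zero_of_l1Norm_le_zero h]⟩
  · refine ⟨c⁻¹ • x, ?_, smul_inv_smul₀ hc.ne' x⟩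
    change l1Norm _ ≤ 1
    rw [l1Norm_smul, abs_of_pos (inv_pos.2 hc), inv_mul_le_iff₀ hc, mul_one]
    exact h

theorem mem_smul_unitBall2 {x : EuclideanSpace ℝ (Fin k)} {c : ℝ} (h : ‖x‖ ≤ c) :
    x ∈ c • unitBall2 k := by
  rcases ((norm_nonneg x).trans h).eq_or_lt with rfl | hc
  · exact ⟨0, by simp [unitBall2], by simp [norm_le_zero_iff.1 h]⟩
  · refine ⟨c⁻¹ • x, ?_, smul_inv_smul₀ hc.ne' x⟩
    change ‖_‖ ≤ 1
    rw [norm_smul, norm_inv, Real.norm_eq_abs, abs_of_pos hc, inv_mul_le_iff₀ hc, mul_one]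
    exact h

theorem norm_le_l1Norm (x : EuclideanSpace ℝ (Fin k)) : ‖x‖ ≤ l1Norm x := by
  rw [EuclideanSpace.norm_eq]
  refine Real.sqrt_le_left (l1Norm_nonneg x) |>.2 ?_
  simp only [Real.norm_eq_abs, l1Norm]
  exact Finset.sum_sq_le_sq_sum_of_nonneg fun i _ => abs_nonneg (x i)

theorem isBounded_unitBall1 : Bornology.IsBounded (unitBall1 k) :=
  isBounded_iff_forall_norm_le.2 ⟨1, fun x h => (norm_le_l1Norm x).trans h⟩

theorem bddAbove_range_inner {B : Set (EuclideanSpace ℝ (Fin k))} (hB : Bornology.IsBounded B)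
    (ξ : EuclideanSpace ℝ (Fin k)) :
    BddAbove (Set.range fun b : B => ⟪(b : EuclideanSpace ℝ (Fin k)), ξ⟫) := by
  obtain ⟨C, hC⟩ := hB.exists_norm_le
  refine ⟨C * ‖ξ‖, ?_⟩
  rintro _ ⟨b, rfl⟩
  exact (real_inner_le_norm _ _).trans (mul_le_mul_of_nonneg_right (hC b b.2) (norm_nonneg _))

theorem inner_le_iSup {B : Set (EuclideanSpace ℝ (Fin k))} (hB : Bornology.IsBounded B)
    {b : EuclideanSpace ℝ (Fin k)} (hb : b ∈ B) (ξ : EuclideanSpace ℝ (Fin k)) :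
    ⟪b, ξ⟫ ≤ ⨆ b : B, ⟪(b : EuclideanSpace ℝ (Fin k)), ξ⟫ :=
  le_ciSup (bddAbove_range_inner hB ξ) ⟨b, hb⟩

/-- The support function of a bounded set is integrable against the standard Gaussian measure. -/
theorem integrable_iSup_inner {B : Set (EuclideanSpace ℝ (Fin k))} (hB : Bornology.IsBounded B) :
    Integrable (fun ξ => ⨆ b : B, ⟪(b : EuclideanSpace ℝ (Fin k)), ξ⟫)
      (stdGaussian (EuclideanSpace ℝ (Fin k))) := by
  rcases B.eq_empty_or_nonempty with rfl | hne
  · simp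
  have : Nonempty B := hne.to_subtype
  obtain ⟨C, hC0, hC⟩ := hB.exists_pos_norm_le
  -- A support function is Lipschitz with constant the radius of the set and vanishes at 0, which
  -- gives both measurability and linear growth.
  have hlip : LipschitzWith C.toNNReal
      (fun ξ => ⨆ b : B, ⟪(b : EuclideanSpace ℝ (Fin k)), ξ⟫) := by
    refine LipschitzWith.of_le_add_mul _ fun ξ η => ciSup_le fun b => ?_
    rw [Real.coe_toNNReal _ hC0.le]
    have h1 : ⟪(b : EuclideanSpace ℝ (Fin k)), ξ⟫ = ⟪(b : EuclideanSpace ℝ (Fin k)), η⟫ +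
        ⟪(b : EuclideanSpace ℝ (Fin k)), ξ - η⟫ := by rw [inner_sub_right]; ring
    rw [h1, dist_eq_norm]
    exact add_le_add (inner_le_iSup hB b.2 η) ((real_inner_le_norm _ _).trans
      (mul_le_mul_of_nonneg_right (hC b b.2) (norm_nonneg _)))
  refine ((IsGaussian.integrable_id (μ := stdGaussian (EuclideanSpace ℝ (Fin k)))).norm.const_mul
    C).mono' hlip.continuous.aestronglyMeasurable (Filter.Eventually.of_forall fun ξ => ?_)
  have h := hlip.dist_le_mul ξ 0
  simpa [Real.coe_toNNReal _ hC0.le] using h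

theorem gaussianWidth_smul {c : ℝ} (hc : 0 ≤ c) (B : Set (EuclideanSpace ℝ (Fin k))) :
    gaussianWidth (c • B) = c * gaussianWidth B := by
  unfold gaussianWidth
  rw [← integral_const_mul]
  congr 1
  ext ξ
  rw [Real.mul_iSup_of_nonneg hc]
  have hs : Function.Surjective (fun b : B => (⟨c • (b : EuclideanSpace ℝ (Fin k)),
      Set.smul_mem_smul_set b.2⟩ : (c • B : Set _))) := by
    rintro ⟨_, b, hb, rfl⟩
    exact ⟨⟨b, hb⟩, rfl⟩
  rw [← hs.iSup_comp]
  simp [real_inner_smul_left]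

/-- The image of the `ℓ₁` ball under a linear map dominates the image of a single vector. -/
theorem inner_le_l1Norm_mul_iSup {m : ℕ}
    (L : EuclideanSpace ℝ (Fin k) →L[ℝ] EuclideanSpace ℝ (Fin m))
    {v : EuclideanSpace ℝ (Fin k)} {R : ℝ} (hv : l1Norm v ≤ R) (ξ : EuclideanSpace ℝ (Fin m)) :
    ⟪L v, ξ⟫ ≤ R * ⨆ b : L '' unitBall1 k, ⟪(b : EuclideanSpace ℝ (Fin m)), ξ⟫ := by
  obtain ⟨w, hw, rfl⟩ := mem_smul_unitBall1 hv
  have hb : Bornology.IsBounded (L '' unitBall1 k) := L.lipschitz.isBounded_image isBounded_unitBall1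
  simp only [map_smul, real_inner_smul_left]
  exact mul_le_mul_of_nonneg_left (inner_le_iSup hb (Set.mem_image_of_mem L hw) ξ)
    ((l1Norm_nonneg _).trans hv)

theorem measurePreserving_toLp_inl (m n : ℕ) :
    MeasurePreserving (fun y : Fin m ⊕ Fin n → ℝ => WithLp.toLp 2 fun i => y (Sum.inl i))
      (stdGaussianPi (Fin m ⊕ Fin n)) (stdGaussian (EuclideanSpace ℝ (Fin m))) := by
  have h1 := measurePreserving_sumPiEquivProdPi (fun _ : Fin m ⊕ Fin n => gaussianReal 0 1)
  have h2 : MeasurePreserving Prod.fst ((stdGaussianPi (Fin m)).prod (stdGaussianPi (Fin n)))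
    (stdGaussianPi (Fin m)) := measurePreserving_fst
  have h3 : MeasurePreserving (WithLp.toLp 2) (stdGaussianPi (Fin m))
    (stdGaussian (EuclideanSpace ℝ (Fin m))) := ⟨by fun_prop, map_pi_eq_stdGaussian⟩
  exact h3.comp (h2.comp h1)

theorem measurePreserving_toLp_inr (m n : ℕ) :
    MeasurePreserving (fun y : Fin m ⊕ Fin n → ℝ => WithLp.toLp 2 fun i => y (Sum.inr i))
      (stdGaussianPi (Fin m ⊕ Fin n)) (stdGaussian (EuclideanSpace ℝ (Fin n))) := by
  have h1 := measurePreserving_sumPiEquivProdPi (fun _ : Fin m ⊕ Fin n => gaussianReal 0 1)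
  have h2 : MeasurePreserving Prod.snd ((stdGaussianPi (Fin m)).prod (stdGaussianPi (Fin n)))
    (stdGaussianPi (Fin n)) := measurePreserving_snd
  have h3 : MeasurePreserving (WithLp.toLp 2) (stdGaussianPi (Fin n))
    (stdGaussian (EuclideanSpace ℝ (Fin n))) := ⟨by fun_prop, map_pi_eq_stdGaussian⟩
  exact h3.comp (h2.comp h1)

/-- Sub-Gaussian deviations of the maximum of a Gaussian bilinear form over finitely many pairs
of unit vectors above the sum of the mean maxima of two linear forms. -/
theorem measureReal_exists_le_bilin_le {m n : ℕ} {ι : Type*} [Fintype ι] [Nonempty ι]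
    {u : ι → EuclideanSpace ℝ (Fin m)} {w : ι → EuclideanSpace ℝ (Fin n)}
    (hu : ∀ i, ‖u i‖ = 1) (hw : ∀ i, ‖w i‖ = 1)
    {G : EuclideanSpace ℝ (Fin m) → ℝ} {H : EuclideanSpace ℝ (Fin n) → ℝ}
    (hG : Integrable G (stdGaussian _)) (hH : Integrable H (stdGaussian _))
    (hGu : ∀ i ξ, ⟪u i, ξ⟫ ≤ G ξ) (hHw : ∀ i ξ, ⟪w i, ξ⟫ ≤ H ξ) {α γ t : ℝ}
    (hα : ∫ ξ, G ξ ∂stdGaussian _ ≤ α) (hγ : ∫ ξ, H ξ ∂stdGaussian _ ≤ γ) (ht : 0 ≤ t) :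
    (stdGaussianPi (Fin m × Fin n)).real
      {x | ∃ i, α + γ + t ≤ (fun q : Fin m × Fin n => u i q.1 * w i q.2) ⬝ᵥ x} ≤
      Real.exp (-t ^ 2 / 2) := by
  have hA : ∀ i j, (fun q : Fin m × Fin n => u i q.1 * w i q.2) ⬝ᵥ
      (fun q : Fin m × Fin n => u j q.1 * w j q.2) = ⟪u i, u j⟫ * ⟪w i, w j⟫ := by
    intro i j
    simp only [dotProduct, Fintype.sum_prod_type, PiLp.inner_apply, Finset.sum_mul_sum]
    refine Finset.sum_congr rfl fun a _ => Finset.sum_congr rfl fun b _ => ?_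
    simp
    ring
  have hB : ∀ i j, Sum.elim (u i).ofLp (w i).ofLp ⬝ᵥ Sum.elim (u j).ofLp (w j).ofLp =
      ⟪u i, u j⟫ + ⟪w i, w j⟫ := by
    intro i j
    simp [dotProduct, PiLp.inner_apply, mul_comm]
  have hx : ∀ i j, |⟪u i, u j⟫| ≤ 1 := fun i j => by
    simpa [hu] using abs_real_inner_le_norm (u i) (u j)
  have hy : ∀ i j, |⟪w i, w j⟫| ≤ 1 := fun i j => by
    simpa [hw] using abs_real_inner_le_norm (w i) (w j)
  have p1 := measurePreserving_toLp_inl m n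
  have p2 := measurePreserving_toLp_inr m n
  have i1 := p1.integrable_comp_of_integrable hG
  have i2 := p2.integrable_comp_of_integrable hH
  refine measureReal_exists_le_dotProduct_le (b := fun i => Sum.elim (u i).ofLp (w i).ofLp)
    (G := fun y => G (WithLp.toLp 2 fun i => y (Sum.inl i)) +
      H (WithLp.toLp 2 fun i => y (Sum.inr i))) ?_ ?_ (i1.add i2) ?_ ?_ ht
  · intro i j
    rw [hA]
    refine (le_abs_self _).trans ?_
    rw [abs_mul]
    exact mul_le_one₀ (hx i j) (abs_nonneg _) (hy i j)
  · intro i j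
    simp only [hA, hB, real_inner_self_eq_norm_sq, hu, hw]
    -- With `x = ⟪u i, u j⟫` and `y = ⟪w i, w j⟫`, the increments are `2 - 2xy` and `4 - 2x - 2y`;
    -- their difference is `2 (1 - x) (1 - y) ≥ 0`.
    nlinarith [(abs_le.1 (hx i j)).2, (abs_le.1 (hy i j)).2]
  · intro y i
    have h1 := hGu i (WithLp.toLp 2 fun i => y (Sum.inl i))
    have h2 := hHw i (WithLp.toLp 2 fun i => y (Sum.inr i))
    refine le_trans (le_of_eq ?_) (add_le_add h1 h2)
    simp [dotProduct, PiLp.inner_apply, mul_comm]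
  · refine (integral_add i1 i2).trans_le ?_
    simp only [Function.comp_apply]
    refine add_le_add (le_trans (le_of_eq ?_) hα) (le_trans (le_of_eq ?_) hγ)
    · rw [← p1.map_eq, integral_map p1.measurable.aemeasurable
        (by rw [p1.map_eq]; exact hG.aestronglyMeasurable)]
    · rw [← p2.map_eq, integral_map p2.measurable.aemeasurable
        (by rw [p2.map_eq]; exact hH.aestronglyMeasurable)]

/-- Sub-Gaussian deviations of the supremum of a Gaussian bilinear form over a product of sets
with controlled Gaussian widths. -/
theorem measure_exists_lt_bilin_le {m n r : ℕ}
    (L : EuclideanSpace ℝ (Fin r) →L[ℝ] EuclideanSpace ℝ (Fin n))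
    {U : Set (EuclideanSpace ℝ (Fin m))} {V : Set (EuclideanSpace ℝ (Fin r))} {α γ t : ℝ}
    (hU : ∀ u ∈ U, ‖u‖ = 1 ∧
      gaussianWidth ((l1Norm u • unitBall1 m) ∩ (‖u‖ • unitBall2 m)) ≤ α)
    (hV : ∀ v ∈ V, ‖L v‖ = 1 ∧ l1Norm v * gaussianWidth (L '' unitBall1 r) ≤ γ) (ht : 0 ≤ t) :
    stdGaussianPi (Fin m × Fin n) {x | ∃ u ∈ U, ∃ v ∈ V,
      α + γ + t < (fun q : Fin m × Fin n => u q.1 * L v q.2) ⬝ᵥ x} ≤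
      ENNReal.ofReal (Real.exp (-t ^ 2 / 2)) := by
  set O : U × V → Set (Fin m × Fin n → ℝ) := fun q =>
    {x | α + γ + t < (fun j : Fin m × Fin n => q.1.1 j.1 * L q.2.1 j.2) ⬝ᵥ x} with hOdef
  have hO : ∀ q, IsOpen (O q) := fun q => by
    refine isOpen_lt continuous_const ?_
    fun_prop
  have hset : {x | ∃ u ∈ U, ∃ v ∈ V,
      α + γ + t < (fun q : Fin m × Fin n => u q.1 * L v q.2) ⬝ᵥ x} = ⋃ q, O q := by
    ext x
    simp [hOdef]
  -- The union may be uncountable. Inner regularity reduces it to compact subsets, hence to finitely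
  -- many pairs, for which the bound does not depend on their number.
  rw [hset, (isOpen_iUnion hO).measure_eq_iSup_isCompact]
  refine iSup₂_le fun K hK => iSup_le fun hKc => ?_
  obtain ⟨s, hs⟩ := hKc.elim_finite_subcover O hO hK
  rcases s.eq_empty_or_nonempty with rfl | hne
  · have : K = ∅ := by simpa using hs
    simp [this]
  have : Nonempty s := hne.to_subtype
  -- Among finitely many vectors, the ones of largest `ℓ₁` norm define bodies that contain (for `v`,
  -- after applying `L`) all the others, so the width bound of a single vector controls the whole
  -- family.
  obtain ⟨i₀, h0⟩ := Finite.exists_max fun q : s => l1Norm q.1.1.1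
  obtain ⟨j₀, h1⟩ := Finite.exists_max fun q : s => l1Norm q.1.2.1
  have hbd : Bornology.IsBounded
      ((l1Norm i₀.1.1.1 • unitBall1 m) ∩ (‖i₀.1.1.1‖ • unitBall2 m)) :=
    (isBounded_unitBall1.smul₀ _).subset Set.inter_subset_left
  have hbd' : Bornology.IsBounded (L '' unitBall1 r) :=
    L.lipschitz.isBounded_image isBounded_unitBall1
  have key := measureReal_exists_le_bilin_le (ι := s) (α := α) (γ := γ) (u := fun q => q.1.1.1)
    (w := fun q => L q.1.2.1) (fun q => (hU _ q.1.1.2).1) (fun q => (hV _ q.1.2.2).1)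
    (integrable_iSup_inner hbd) ((integrable_iSup_inner hbd').const_mul (l1Norm j₀.1.2.1))
    (fun q ξ => inner_le_iSup hbd ⟨mem_smul_unitBall1 (h0 q), mem_smul_unitBall2
      ((hU _ q.1.1.2).1.trans (hU _ i₀.1.1.2).1.symm).le⟩ ξ)
    (fun q ξ => inner_le_l1Norm_mul_iSup L (h1 q) ξ)
    (hU _ i₀.1.1.2).2 ((integral_const_mul _ _).trans_le (hV _ j₀.1.2.2).2) ht
  refine (measure_mono (hs.trans ?_)).trans
    ((ENNReal.le_ofReal_iff_toReal_le (measure_ne_top _ _) (Real.exp_pos _).le).2 key)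
  intro x hx
  obtain ⟨q, hq, hxq⟩ := Set.mem_iUnion₂.1 hx
  exact ⟨⟨q, hq⟩, le_of_lt hxq⟩

end Width

/-! ### Reduction to independent standard Gaussian entries -/

section Rows

theorem measurePreserving_curry_stdGaussianPi (κ κ' : Type*) [Fintype κ] [Fintype κ'] :
    MeasurePreserving (fun (x : κ × κ' → ℝ) i j => x (i, j)) (stdGaussianPi (κ × κ'))
      (Measure.pi fun _ : κ => stdGaussianPi κ') := by
  refine ⟨by fun_prop, ?_⟩
  have h := Measure.infinitePi_map_curry (fun (_ : κ) (_ : κ') => gaussianReal 0 1)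
  simp only [Measure.infinitePi_eq_pi] at h
  exact h

open scoped MatrixOrder in
theorem inner_covSqrt_left {p : ℕ} (S : Matrix (Fin p) (Fin p) ℝ)
    (x y : EuclideanSpace ℝ (Fin p)) : ⟪covSqrt S x, y⟫ = ⟪x, covSqrt S y⟫ := by
  have h : IsSelfAdjoint (covSqrt S) := (CFC.sqrt_nonneg S).isSelfAdjoint.map _
  rw [← ContinuousLinearMap.adjoint_inner_right, h.adjoint_eq]

theorem measurePreserving_covSqrt {p : ℕ} (S : Matrix (Fin p) (Fin p) ℝ) :
    MeasurePreserving (covSqrt S) (stdGaussian (EuclideanSpace ℝ (Fin p)))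
      (multivariateGaussian 0 S) := by
  refine ⟨by fun_prop, ?_⟩
  simp only [multivariateGaussian, zero_add]
  rfl

variable {Ω : Type*} [MeasurableSpace Ω] {P : Measure Ω}
  {n p : ℕ} {S : Matrix (Fin p) (Fin p) ℝ} {Z : Ω → Matrix (Fin n) (Fin p) ℝ}

/-- Events about a matrix with independent Gaussian rows may be computed by applying the square
root of the covariance to the rows of a matrix with independent standard Gaussian entries. -/
theorem HasIIDGaussianRows.measure_preimage (hZ : HasIIDGaussianRows P S Z)
    {A : Set (Fin n → EuclideanSpace ℝ (Fin p))} (hA : MeasurableSet A) :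
    P {ω | (fun i => rowVec (Z ω) i) ∈ A} = stdGaussianPi (Fin n × Fin p)
      {x | (fun i => covSqrt S (WithLp.toLp 2 fun l => x (i, l))) ∈ A} := by
  have hm : ∀ i, AEMeasurable (fun ω => rowVec (Z ω) i) P := fun i => (hZ.hasLaw i).aemeasurable
  have h1 := hZ.indep.map_fun_eq_pi_map hm
  simp only [fun i => (hZ.hasLaw i).map_eq] at h1
  have h3 : MeasurePreserving (WithLp.toLp 2) (stdGaussianPi (Fin p))
    (stdGaussian (EuclideanSpace ℝ (Fin p))) := ⟨by fun_prop, map_pi_eq_stdGaussian⟩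
  have h4 := (measurePreserving_pi (fun _ : Fin n => stdGaussianPi (Fin p))
    (fun _ : Fin n => multivariateGaussian 0 S)
    fun _ => (measurePreserving_covSqrt S).comp h3).comp
      (measurePreserving_curry_stdGaussianPi (Fin n) (Fin p))
  have h5 := h4.measure_preimage hA.nullMeasurableSet
  rw [← h1, Measure.map_apply_of_aemeasurable (aemeasurable_pi_lambda _ hm) hA] at h5
  exact h5.symm

/-- A row has the law of `Σ^{1/2} x`, and `Σ^{1/2}` is self-adjoint. The condition over all `v` at
once defines a closed set, so a single null event suffices. -/
theorem HasIIDGaussianRows.ae_inner_eq_zero (hZ : HasIIDGaussianRows P S Z) :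
    ∀ᵐ ω ∂P, ∀ i v, covSqrt S v = 0 → ⟪rowVec (Z ω) i, v⟫ = 0 := by
  refine ae_all_iff.2 fun i => ?_
  have hm : MeasurableSet {r : EuclideanSpace ℝ (Fin p) | ∀ v, covSqrt S v = 0 → ⟪r, v⟫ = 0} := by
    simp only [Set.ofPred_forall]
    exact (isClosed_iInter fun v => isClosed_iInter fun _ =>
      isClosed_eq (by fun_prop) continuous_const).measurableSet
  refine (ae_map_iff (hZ.hasLaw i).aemeasurable hm).1 ?_
  rw [(hZ.hasLaw i).map_eq, ← (measurePreserving_covSqrt S).map_eq,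
    ae_map_iff (by fun_prop) hm]
  refine Filter.Eventually.of_forall fun x v hv => ?_
  rw [inner_covSqrt_left, hv, inner_zero_right]

/-- Deviations of the bilinear form of a matrix with independent Gaussian rows over sets with
controlled Gaussian widths. -/
theorem HasIIDGaussianRows.measure_exists_lt_le (hZ : HasIIDGaussianRows P S Z)
    {U : Set (EuclideanSpace ℝ (Fin n))} {V : Set (EuclideanSpace ℝ (Fin p))} {α γ t : ℝ}
    (hU : ∀ u ∈ U, ‖u‖ = 1 ∧
      gaussianWidth ((l1Norm u • unitBall1 n) ∩ (‖u‖ • unitBall2 n)) ≤ α)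
    (hV : ∀ v ∈ V, ‖covSqrt S v‖ = 1 ∧
      l1Norm v * gaussianWidth (covSqrt S '' unitBall1 p) ≤ γ) (ht : 0 ≤ t) :
    P {ω | ∃ u ∈ U, ∃ v ∈ V, α + γ + t < ∑ i, u i * ⟪rowVec (Z ω) i, v⟫} ≤
      ENNReal.ofReal (Real.exp (-t ^ 2 / 2)) := by
  have hA : IsOpen {r : Fin n → EuclideanSpace ℝ (Fin p) |
      ∃ u ∈ U, ∃ v ∈ V, α + γ + t < ∑ i, u i * ⟪r i, v⟫} := by
    simp only [Set.ofPred_exists, Set.ofPred_and]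
    refine isOpen_iUnion fun u => isOpen_const.inter (isOpen_iUnion fun v => isOpen_const.inter ?_)
    exact isOpen_lt continuous_const (by fun_prop)
  have h := hZ.measure_preimage hA.measurableSet
  refine (h.trans_le (measure_mono ?_)).trans (measure_exists_lt_bilin_le (covSqrt S) hU hV ht)
  rintro x ⟨u, hu, v, hv, hx⟩
  refine ⟨u, hu, v, hv, hx.trans_eq ?_⟩
  simp only [inner_covSqrt_left]
  simp only [dotProduct, Fintype.sum_prod_type, PiLp.inner_apply,
    Finset.mul_sum]
  refine Finset.sum_congr rfl fun i _ => Finset.sum_congr rfl fun j _ => ?_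
  simp
  ring

end Rows

theorem gaussianWidth_nonneg {k : ℕ} {B : Set (EuclideanSpace ℝ (Fin k))}
    (hB : Bornology.IsBounded B) (h0 : 0 ∈ B) : 0 ≤ gaussianWidth B :=
  integral_nonneg fun ξ => by simpa using inner_le_iSup hB h0 ξ

theorem gaussianWidth_image_unitBall1_nonneg {k m : ℕ}
    (L : EuclideanSpace ℝ (Fin k) →L[ℝ] EuclideanSpace ℝ (Fin m)) :
    0 ≤ gaussianWidth (L '' unitBall1 k) :=
  gaussianWidth_nonneg (L.lipschitz.isBounded_image isBounded_unitBall1)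
    ⟨0, zero_mem_unitBall1, map_zero L⟩

theorem gaussianWidth_inter_nonneg {k : ℕ} (u : EuclideanSpace ℝ (Fin k)) :
    0 ≤ gaussianWidth ((l1Norm u • unitBall1 k) ∩ (‖u‖ • unitBall2 k)) :=
  gaussianWidth_nonneg ((isBounded_unitBall1.smul₀ _).subset Set.inter_subset_left)
    ⟨⟨0, zero_mem_unitBall1, smul_zero _⟩, ⟨0, by simp [unitBall2], smul_zero _⟩⟩

theorem gaussianWidth_inter_smul {k : ℕ} (u : EuclideanSpace ℝ (Fin k)) {c : ℝ} (hc : 0 < c) :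
    gaussianWidth ((l1Norm (c • u) • unitBall1 k) ∩ (‖c • u‖ • unitBall2 k)) =
      c * gaussianWidth ((l1Norm u • unitBall1 k) ∩ (‖u‖ • unitBall2 k)) := by
  rw [← gaussianWidth_smul hc.le, Set.smul_set_inter₀ hc.ne', smul_smul, smul_smul, l1Norm_smul,
    norm_smul, Real.norm_eq_abs, abs_of_pos hc]

/-- Ensures `√2 * √(log (81 / δ)) ≥ 2`, which makes the cross term in the squared deviation level
dominate the shell indices. -/
theorem two_le_log_div {δ : ℝ} (hδ : δ ∈ Set.Ioc (0 : ℝ) 1) : 2 ≤ Real.log (81 / δ) := by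
  have h1 : (81 : ℝ) ≤ 81 / δ := by
    rw [le_div_iff₀ hδ.1]
    linarith [hδ.2]
  rw [Real.le_log_iff_exp_le (by linarith)]
  refine le_trans ?_ h1
  have h2 : Real.exp 2 = Real.exp 1 * Real.exp 1 := by rw [← Real.exp_add]; norm_num
  rw [h2]
  nlinarith [Real.exp_one_lt_d9, Real.exp_pos 1]

/-- The tail on the `(j, k)`-th shell is a geometric fraction of the total error probability. -/
theorem exp_neg_sq_div_two_le {δ : ℝ} (hδ : δ ∈ Set.Ioc (0 : ℝ) 1) (j k : ℕ) :
    Real.exp (-(√2 * √(Real.log (81 / δ)) + 0.6 * (j + k)) ^ 2 / 2) ≤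
      δ / 4 * ((2 : ℝ)⁻¹ ^ j * (2 : ℝ)⁻¹ ^ k) := by
  have hL := two_le_log_div hδ
  set L := Real.log (81 / δ)
  have hs : 2 ≤ √2 * √L := by
    rw [← Real.sqrt_mul (by norm_num)]
    exact Real.le_sqrt_of_sq_le (by linarith)
  have hs2 : (√2 * √L) ^ 2 = 2 * L := by
    rw [mul_pow, Real.sq_sqrt (by norm_num), Real.sq_sqrt (by linarith)]
  have hm : (0 : ℝ) ≤ (j : ℝ) + k := by positivity
  -- With `r = √2 * √L ≥ 2` and `m = j + k`, the square over 2 is at least `r² / 2 + 0.6 r m ≥ L +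
  -- 1.2 m`.
  have h1 : -(√2 * √L + 0.6 * ((j : ℝ) + k)) ^ 2 / 2 ≤ -L + (-(j : ℝ) + -(k : ℝ)) := by
    nlinarith [mul_le_mul_of_nonneg_right hs hm, sq_nonneg ((j : ℝ) + k)]
  have h2 : Real.exp (-L) = δ / 81 := by
    rw [Real.exp_neg, Real.exp_log (div_pos (by norm_num) hδ.1), inv_div]
  have h3 : ∀ i : ℕ, Real.exp (-(i : ℝ)) ≤ (2 : ℝ)⁻¹ ^ i := by
    intro i
    rw [← mul_neg_one (i : ℝ), Real.exp_nat_mul, Real.exp_neg]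
    refine pow_le_pow_left₀ (by positivity) (inv_anti₀ (by norm_num) ?_) _
    linarith [Real.add_one_le_exp (1 : ℝ)]
  refine (Real.exp_le_exp.2 h1).trans ?_
  rw [Real.exp_add, Real.exp_add, h2]
  exact mul_le_mul (by linarith [hδ.1]) (mul_le_mul (h3 j) (h3 k) (Real.exp_pos _).le
    (by positivity)) (by positivity) (by linarith [hδ.1])

/-! ### Peeling over shells and homogeneity -/

section Peeling

variable {Ω : Type*} [MeasurableSpace Ω] {P : Measure Ω}
  {n p : ℕ} {S : Matrix (Fin p) (Fin p) ℝ} {Z : Ω → Matrix (Fin n) (Fin p) ℝ}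

/-- The bound on the bilinear form holds uniformly over unit vectors outside of an event of
small probability. -/
theorem HasIIDGaussianRows.measure_exists_unit_le (hZ : HasIIDGaussianRows P S Z) {δ : ℝ}
    (hδ : δ ∈ Set.Ioc (0 : ℝ) 1) :
    P {ω | ∃ (u : EuclideanSpace ℝ (Fin n)) (v : EuclideanSpace ℝ (Fin p)),
      ‖u‖ = 1 ∧ ‖covSqrt S v‖ = 1 ∧ √2 * (4.8 + √(Real.log (81 / δ))) +
        1.2 * (l1Norm v * gaussianWidth (covSqrt S '' unitBall1 p)) +
        1.2 * gaussianWidth ((l1Norm u • unitBall1 n) ∩ (‖u‖ • unitBall2 n)) <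
        ∑ i, u i * ⟪rowVec (Z ω) i, v⟫} ≤ ENNReal.ofReal δ := by
  set g := gaussianWidth (covSqrt S '' unitBall1 p)
  set w : EuclideanSpace ℝ (Fin n) → ℝ := fun u =>
    gaussianWidth ((l1Norm u • unitBall1 n) ∩ (‖u‖ • unitBall2 n)) with hw
  set r := √2 * √(Real.log (81 / δ))
  -- The sets carry only the upper end of a shell of width 3, which is what the tail bound needs;
  -- the lower end enters later through the integer parts.
  set U : ℕ → Set (EuclideanSpace ℝ (Fin n)) := fun k => {u | ‖u‖ = 1 ∧ w u ≤ 3 * (k + 1)}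
  set V : ℕ → Set (EuclideanSpace ℝ (Fin p)) := fun j =>
    {v | ‖covSqrt S v‖ = 1 ∧ l1Norm v * g ≤ 3 * (j + 1)}
  have hr : 0 ≤ r := by positivity
  have hshell : ∀ k j : ℕ, P {ω | ∃ u ∈ U k, ∃ v ∈ V j,
      3 * ((k : ℝ) + 1) + 3 * (j + 1) + (r + 0.6 * (j + k)) < ∑ i, u i * ⟪rowVec (Z ω) i, v⟫} ≤
      ENNReal.ofReal (δ / 4) * ((2 : ENNReal)⁻¹ ^ j * (2 : ENNReal)⁻¹ ^ k) := by
    intro k j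
    refine (hZ.measure_exists_lt_le (U := U k) (V := V j) (fun u hu => hu) (fun v hv => hv)
      (by positivity)).trans ((ENNReal.ofReal_le_ofReal (exp_neg_sq_div_two_le hδ j k)).trans_eq ?_)
    have h2 : ENNReal.ofReal (2 : ℝ)⁻¹ = (2 : ENNReal)⁻¹ := by
      rw [ENNReal.ofReal_inv_of_pos (by norm_num)]
      norm_num
    rw [ENNReal.ofReal_mul (by linarith [hδ.1]), ENNReal.ofReal_mul (by positivity),
      ENNReal.ofReal_pow (by norm_num), ENNReal.ofReal_pow (by norm_num), h2]
  have hsum : ∑' k : ℕ, ∑' j : ℕ, ENNReal.ofReal (δ / 4) *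
      ((2 : ENNReal)⁻¹ ^ j * (2 : ENNReal)⁻¹ ^ k) = ENNReal.ofReal δ := by
    simp only [ENNReal.tsum_mul_left, ENNReal.tsum_mul_right, ENNReal.tsum_geometric,
      ENNReal.one_sub_inv_two, inv_inv]
    rw [show (2 : ENNReal) = ENNReal.ofReal 2 by norm_num, ← ENNReal.ofReal_mul (by norm_num),
      ← ENNReal.ofReal_mul (by linarith [hδ.1])]
    congr 1
    ring
  refine (measure_mono ?_).trans ((measure_iUnion_le _).trans ((ENNReal.tsum_le_tsum fun k =>
    (measure_iUnion_le _).trans (ENNReal.tsum_le_tsum fun j => hshell k j)).trans_eq hsum))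
  rintro ω ⟨u, v, hu, hv, h⟩
  simp only [Set.mem_iUnion]
  have ha : 0 ≤ l1Norm v * g :=
    mul_nonneg (l1Norm_nonneg v) (gaussianWidth_image_unitBall1_nonneg _)
  have hb : 0 ≤ w u := gaussianWidth_inter_nonneg u
  have h1 := Nat.floor_le (div_nonneg ha (by norm_num : (0 : ℝ) ≤ 3))
  have h2 := Nat.floor_le (div_nonneg hb (by norm_num : (0 : ℝ) ≤ 3))
  have h3 := Nat.lt_floor_add_one (l1Norm v * g / 3)
  have h4 := Nat.lt_floor_add_one (w u / 3)
  -- The threshold on a shell is `6 + 3.6 (j + k) + r`. Here `3.6 = 1.2 * 3`, and `3j`, `3k` lie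
  -- below the two widths, while `6 ≤ 4.8 * 1.4 ≤ 4.8 * √2`.
  have h5 : (1.4 : ℝ) ≤ √2 := Real.le_sqrt_of_sq_le (by norm_num)
  refine ⟨⌊w u / 3⌋₊, ⌊l1Norm v * g / 3⌋₊, u, ⟨hu, by linarith⟩, v, ⟨hv, by linarith⟩,
    lt_of_le_of_lt ?_ h⟩
  have e : √2 * (4.8 + √(Real.log (81 / δ))) = √2 * 4.8 + r := mul_add _ _ _
  change _ ≤ _ + _ + 1.2 * w u
  rw [e]
  linarith

/-- From unit vectors to arbitrary vectors, by homogeneity. -/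
theorem abs_sum_mul_inner_le {R : Fin n → EuclideanSpace ℝ (Fin p)} {C : ℝ} (hC : 0 ≤ C)
    (hker : ∀ i v, covSqrt S v = 0 → ⟪R i, v⟫ = 0)
    (hunit : ∀ (u : EuclideanSpace ℝ (Fin n)) (v : EuclideanSpace ℝ (Fin p)),
      ‖u‖ = 1 → ‖covSqrt S v‖ = 1 → ∑ i, u i * ⟪R i, v⟫ ≤ C +
        1.2 * (l1Norm v * gaussianWidth (covSqrt S '' unitBall1 p)) +
        1.2 * gaussianWidth ((l1Norm u • unitBall1 n) ∩ (‖u‖ • unitBall2 n)))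
    (u : EuclideanSpace ℝ (Fin n)) (v : EuclideanSpace ℝ (Fin p)) :
    |∑ i, u i * ⟪R i, v⟫| ≤ ‖covSqrt S v‖ * ‖u‖ * C +
        1.2 * l1Norm v * ‖u‖ * gaussianWidth (covSqrt S '' unitBall1 p) +
        1.2 * ‖covSqrt S v‖ *
          gaussianWidth ((l1Norm u • unitBall1 n) ∩ (‖u‖ • unitBall2 n)) := by
  set g := gaussianWidth (covSqrt S '' unitBall1 p)
  have hg : 0 ≤ g := gaussianWidth_image_unitBall1_nonneg _
  have hG := gaussianWidth_inter_nonneg u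
  have hl := l1Norm_nonneg v
  by_cases hv : covSqrt S v = 0
  · simp only [hker _ v hv, mul_zero, Finset.sum_const_zero, abs_zero]
    positivity
  by_cases hu : u = 0
  · have h0 : ∑ i, u i * ⟪R i, v⟫ = 0 := by simp [hu]
    rw [h0, abs_zero]
    positivity
  have hu' : 0 < ‖u‖ := norm_pos_iff.2 hu
  have hv' : 0 < ‖covSqrt S v‖ := norm_pos_iff.2 hv
  -- Replacing `u` by `-u` changes neither of its norms, so the one-sided bound controls the
  -- absolute value.
  have h1 : ∀ s : ℝ, |s| = 1 → s * ∑ i, u i * ⟪R i, v⟫ ≤ ‖covSqrt S v‖ * ‖u‖ * C +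
        1.2 * l1Norm v * ‖u‖ * g + 1.2 * ‖covSqrt S v‖ *
          gaussianWidth ((l1Norm u • unitBall1 n) ∩ (‖u‖ • unitBall2 n)) := by
    intro s hs
    have key := hunit (s • ‖u‖⁻¹ • u) (‖covSqrt S v‖⁻¹ • v)
      (by rw [norm_smul, norm_smul, norm_inv, norm_norm, inv_mul_cancel₀ hu'.ne', mul_one]
          exact hs)
      (by rw [map_smul, norm_smul, norm_inv, norm_norm, inv_mul_cancel₀ hv'.ne'])
    have e1 : l1Norm (s • ‖u‖⁻¹ • u) = l1Norm (‖u‖⁻¹ • u) := by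
      rw [l1Norm_smul s, hs, one_mul]
    have e2 : ‖s • ‖u‖⁻¹ • u‖ = ‖‖u‖⁻¹ • u‖ := by
      rw [norm_smul s, Real.norm_eq_abs, hs, one_mul]
    have e3 : ∑ i, (s • ‖u‖⁻¹ • u) i * ⟪R i, ‖covSqrt S v‖⁻¹ • v⟫ =
        ‖u‖⁻¹ * ‖covSqrt S v‖⁻¹ * (s * ∑ i, u i * ⟪R i, v⟫) := by
      simp only [Finset.mul_sum, real_inner_smul_right, PiLp.smul_apply, smul_eq_mul]
      exact Finset.sum_congr rfl fun i _ => by ring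
    rw [e1, e2, gaussianWidth_inter_smul u (inv_pos.2 hu'), e3, l1Norm_smul,
      abs_of_pos (inv_pos.2 hv')] at key
    have := mul_le_mul_of_nonneg_left key (mul_nonneg hu'.le hv'.le)
    refine (le_of_eq ?_).trans (this.trans (le_of_eq ?_)) <;> field_simp
  refine abs_le'.2 ⟨?_, ?_⟩
  · simpa using h1 1 (by simp)
  · simpa using h1 (-1) (by simp)

end Peeling

/-! ### Conclusion -/

theorem mainTheorem7 {Ω : Type*} [MeasurableSpace Ω] (P : Measure Ω) [IsProbabilityMeasure P]
    (n p : ℕ) (hn : 1 ≤ n) (S : Matrix (Fin p) (Fin p) ℝ) (hS : S.PosSemidef)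
    (Z : Ω → Matrix (Fin n) (Fin p) ℝ) (hZ : HasIIDGaussianRows P S Z)
    (δ : ℝ) (hδ : δ ∈ Set.Ioc (0 : ℝ) 1) :
    1 - δ ≤ P.real {ω | ∀ (v : EuclideanSpace ℝ (Fin p)) (u : EuclideanSpace ℝ (Fin n)),
      |u.ofLp ⬝ᵥ ((1 / √(n : ℝ)) • Z ω).mulVec v.ofLp| ≤
        ‖covSqrt S v‖ * ‖u‖ * √(2 / (n : ℝ)) * (4.8 + √(Real.log (81 / δ)))
        + 1.2 * l1Norm v * ‖u‖ * (gaussianWidth (covSqrt S '' unitBall1 p) / √(n : ℝ))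
        + 1.2 * ‖covSqrt S v‖ *
          (gaussianWidth ((l1Norm u • unitBall1 n) ∩ (‖u‖ • unitBall2 n)) / √(n : ℝ))} := by
  set good := {ω | ∀ (v : EuclideanSpace ℝ (Fin p)) (u : EuclideanSpace ℝ (Fin n)),
      |u.ofLp ⬝ᵥ ((1 / √(n : ℝ)) • Z ω).mulVec v.ofLp| ≤
        ‖covSqrt S v‖ * ‖u‖ * √(2 / (n : ℝ)) * (4.8 + √(Real.log (81 / δ)))
        + 1.2 * l1Norm v * ‖u‖ * (gaussianWidth (covSqrt S '' unitBall1 p) / √(n : ℝ))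
        + 1.2 * ‖covSqrt S v‖ *
          (gaussianWidth ((l1Norm u • unitBall1 n) ∩ (‖u‖ • unitBall2 n)) / √(n : ℝ))} with hgood
  have hbad : P goodᶜ ≤ ENNReal.ofReal δ := by
    refine (measure_mono_ae ?_).trans (hZ.measure_exists_unit_le hδ)
    filter_upwards [hZ.ae_inner_eq_zero] with ω hker hω
    by_contra hnot
    refine hω fun v u => ?_
    have hunit : ∀ (u : EuclideanSpace ℝ (Fin n)) (v : EuclideanSpace ℝ (Fin p)),
        ‖u‖ = 1 → ‖covSqrt S v‖ = 1 → ∑ i, u i * ⟪rowVec (Z ω) i, v⟫ ≤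
          √2 * (4.8 + √(Real.log (81 / δ))) +
          1.2 * (l1Norm v * gaussianWidth (covSqrt S '' unitBall1 p)) +
          1.2 * gaussianWidth ((l1Norm u • unitBall1 n) ∩ (‖u‖ • unitBall2 n)) :=
      fun u v hu hv => not_lt.1 fun h => hnot ⟨u, v, hu, hv, h⟩
    have h := abs_sum_mul_inner_le (by positivity) hker hunit u v
    have e : u.ofLp ⬝ᵥ ((1 / √(n : ℝ)) • Z ω).mulVec v.ofLp =
        (∑ i, u i * ⟪rowVec (Z ω) i, v⟫) / √(n : ℝ) := by
      rw [Matrix.smul_mulVec, dotProduct_smul, smul_eq_mul, one_div, inv_mul_eq_div]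
      congr 1
      refine Finset.sum_congr rfl fun i _ => ?_
      congr 1
      simp [Matrix.mulVec, dotProduct, PiLp.inner_apply, rowVec, mul_comm]
    rw [e, abs_div, abs_of_nonneg (Real.sqrt_nonneg _), Real.sqrt_div (by norm_num)]
    refine (div_le_div_of_nonneg_right h (Real.sqrt_nonneg _)).trans_eq ?_
    ring
  -- Subadditivity of the outer measure suffices, so measurability of `good` plays no role.
  have h1 : (1 : ENNReal) ≤ P good + ENNReal.ofReal δ := by
    rw [← measure_univ (μ := P), ← Set.union_compl_self good]
    exact (measure_union_le _ _).trans (add_le_add_right hbad _)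
  have h2 := ENNReal.toReal_mono (by simp) h1
  rw [ENNReal.toReal_add (measure_ne_top _ _) ENNReal.ofReal_ne_top,
    ENNReal.toReal_ofReal hδ.1.le, ENNReal.toReal_one] at h2
  rw [measureReal_def]
  linarith
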